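/- Let $F$ be the free group with basis $\mathcal B$ of size $n$, let $\mathcal T$ be its Cayley tree with respect to $\mathcal B$, and let $\partial_\infty F=\partial_\infty\mathcal T$ be its boundary. Let $\mathcal L$ be the line pattern given by a finite list of words $w_i$ in $\mathcal B^{\pm1}$: the set of lines $\{g w_i^k\}_{k\in\mathbb Z}$, $g\in F$ (words representing the identity contribute no line). Let $\mathcal D$ be the decomposition space, the quotient $q\colon\partial_\infty F\to\mathcal D$ of $\partial_\infty F$ that identifies the two ends of each line in $\mathcal L$. For a nonempty finite subtree $\mathcal X\subset\mathcal T$ let $\mathrm{Wh}(\mathcal X)$ be the Whitehead graph: its vertices are the vertices of $\mathcal T\setminus\mathcal X$ adjacent to $\mathcal X$, and two distinct vertices $a,b$ are joined by an edge for each line of $\mathcal L$ with one end in the shadow of $a$ and the other in the shadow of $b$, where the shadow $S(a)$ is the set of $\xi\in\partial_\infty F$ such that the geodesics from $\mathcal X$ to $\xi$ pass through $a$. A cover associated with $\mathcal X$ is an open cover $\mathcal U_{\mathcal X}=(U_a)$ of $\mathcal D$ indexed by the vertices of $\mathrm{Wh}(\mathcal X)$ such that $q(S(a))\subset U_a$,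 such that for $a\ne b$ one has $U_a\cap U_b\neq\emptyset$ iff $a,b$ are adjacent in $\mathrm{Wh}(\mathcal X)$, and such that no three members with distinct indices have a common point. A 1-cochain of $\mathcal U_{\mathcal X}$ assigns an integer to each pair of members with distinct indices and nonempty intersection; pairs may be taken ordered, with alternating cochains (as in the Čech complex), or unordered. If $\mathcal X\subset\mathcal X'$ and each $U'_b\in\mathcal U_{\mathcal X'}$ is contained in $U_{\pi(b)}\in\mathcal U_{\mathcal X}$, where $\pi(b)$ is the vertex through which one leaves $\mathcal X$ on the way to $b$, then refinement induces a map $\check{\mathrm C}^1(\mathcal U_{\mathcal X},\mathbb Z)\to\check{\mathrm C}^1(\mathcal U_{\mathcal X'},\mathbb Z)$ by pull-back along $\pi$ (the value is $0$ on pairs with $\pi(b)=\pi(b')$). Let $\varinjlim\check{\mathrm C}^1(\mathcal U_{\mathcal X},\mathbb Z)$ be the direct limit along these maps, over all finite subtrees and their associated covers. An element of it is supported on $\mathcal X$ if it is represented by a 1-cochain of a cover associated with $\mathcal X$. Theorem. There is a computable function $N$ of the list of words defining $\mathcal L$ and of $n$ such that, for all $n$ and $\mathcal L$ (and for either kind of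 cochains), $\varinjlim\check{\mathrm C}^1(\mathcal U_{\mathcal X},\mathbb Z)$ is generated as an abelian group by elements supported on finite subtrees with fewer than $N(\mathcal L,n)$ vertices. -/

import Mathlib

open Filter Topology

noncomputable section

namespace DecompositionCohomology

/-! ## The Cayley tree and its boundary -/

/-- The Cayley graph `𝒯` of the free group `F` on `Fin n`: `g` and `h` are adjacent iff they
differ by right multiplication by a basis element. The group acts on it by left translation. -/
abbrev cayleyTree (n : ℕ) : SimpleGraph (FreeGroup (Fin n)) :=
  SimpleGraph.mulCayley (Set.range FreeGroup.of)

/-- A boundary point of the Cayley tree: a geodesic ray from the identity, that is, an infinite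
reduced word. The letter `(i, true)` is the `i`-th basis element, `(i, false)` its inverse. -/
def Boundary (n : ℕ) : Type :=
  {ξ : ℕ → Fin n × Bool // ∀ k, ξ (k + 1) ≠ ((ξ k).1, !(ξ k).2)}

/-- The topology of the boundary: that of a subspace of the product of discrete spaces. -/
instance (n : ℕ) : TopologicalSpace (Boundary n) :=
  inferInstanceAs (TopologicalSpace {ξ : ℕ → Fin n × Bool // ∀ k, ξ (k + 1) ≠ ((ξ k).1, !(ξ k).2)})

namespace Boundary

variable {n : ℕ}

/-- The first `k` letters of a boundary point. -/
def initial (ξ : Boundary n) (k : ℕ) : List (Fin n × Bool) := (List.range k).map ξ.1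

/-- The `k`-th vertex of the geodesic ray from the identity to `ξ`. -/
def ray (ξ : Boundary n) (k : ℕ) : FreeGroup (Fin n) := FreeGroup.mk (ξ.initial k)

/-- The sequence `u` of vertices converges to the boundary point `ξ`: every initial segment of `ξ`
is eventually an initial segment of the reduced word of `u k`. -/
def IsLimitOf (ξ : Boundary n) (u : ℕ → FreeGroup (Fin n)) : Prop :=
  ∀ m, ∀ᶠ k in atTop, ξ.initial m <+: (u k).toWord

end Boundary

/-! ## Line patterns and the decomposition space -/

/-- `ξ` and `η` are the two ends (`k → ∞` and `k → -∞`) of a line `{g w ^ k}` of the line pattern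
given by the list `L` of words. (A word representing the identity contributes no line.) -/
def JoinedByLine {n : ℕ} (L : List (List (Fin n × Bool))) (ξ η : Boundary n) : Prop :=
  ∃ w ∈ L, ∃ g : FreeGroup (Fin n),
    ξ.IsLimitOf (fun k => g * FreeGroup.mk w ^ k) ∧
    η.IsLimitOf (fun k => g * (FreeGroup.mk w)⁻¹ ^ k)

/-- The decomposition space: the quotient of the boundary that identifies the two ends of each
line of the line pattern, with the quotient topology. -/
def DecompositionSpace {n : ℕ} (L : List (List (Fin n × Bool))) : Type :=
  Quot (JoinedByLine L)

instance {n : ℕ} (L : List (List (Fin n × Bool))) : TopologicalSpace (DecompositionSpace L) :=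
  inferInstanceAs (TopologicalSpace (Quot (JoinedByLine L)))

/-- The quotient projection `q`. -/
def proj {n : ℕ} (L : List (List (Fin n × Bool))) : Boundary n → DecompositionSpace L :=
  Quot.mk _

/-! ## Finite subtrees and Whitehead graphs -/

/-- A (nonempty) finite subtree of the Cayley tree. -/
structure FiniteSubtree (n : ℕ) where
  verts : Finset (FreeGroup (Fin n))
  connected : ((cayleyTree n).induce (verts : Set (FreeGroup (Fin n)))).Connected

namespace FiniteSubtree

variable {n : ℕ}

/-- The vertices of the Whitehead graph at `X`: the vertices of the Cayley tree outside `X` that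
are adjacent to `X`. -/
abbrev WhVertex (X : FiniteSubtree n) : Type :=
  {a : FreeGroup (Fin n) // a ∉ X.verts ∧ ∃ x ∈ X.verts, (cayleyTree n).Adj x a}

/-- `u` lies in the component of `𝒯 - X` that contains `a`, that is (for `a` adjacent to `X`), the
geodesics from `X` to `u` pass through `a`. -/
def Beyond (X : FiniteSubtree n) (a : X.WhVertex) (u : FreeGroup (Fin n)) : Prop :=
  ∃ p : (cayleyTree n).Walk a.1 u, ∀ z ∈ p.support, z ∉ X.verts

/-- The shadow of `a` from `X`: the boundary points `ξ` such that the geodesics from `X` to `ξ`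
pass through `a`. When `X` contains the identity `e` this is the shadow `S^e(a)`. -/
def shadow (X : FiniteSubtree n) (a : X.WhVertex) : Set (Boundary n) :=
  {ξ | ∀ᶠ k in atTop, X.Beyond a (ξ.ray k)}

/-- The Whitehead graph of the line pattern at `X`: distinct vertices `a`, `b` are adjacent iff
some line of the pattern runs between them. (Several lines between the same two vertices are
several edges in the usual multigraph; cochains do not distinguish them.) -/
def whiteheadGraph (L : List (List (Fin n × Bool))) (X : FiniteSubtree n) :
    SimpleGraph X.WhVertex :=
  SimpleGraph.fromRel fun a b => ∃ ξ ∈ X.shadow a, ∃ η ∈ X.shadow b, JoinedByLine L ξ η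

end FiniteSubtree

/-! ## Covers of the decomposition space associated with finite subtrees -/

/-- An open cover `𝒰_X = (U_a)` of the decomposition space associated with the finite subtree `X`:
it is indexed by the vertices of the Whitehead graph at `X`, contains the shadows, has the
Whitehead graph as the 1-skeleton of its nerve and has no triple intersections. -/
structure AssociatedCover {n : ℕ} (L : List (List (Fin n × Bool))) (X : FiniteSubtree n) where
  U : X.WhVertex → Set (DecompositionSpace L)
  isOpen : ∀ a, IsOpen (U a)
  covers : ⋃ a, U a = Set.univ
  shadow_subset : ∀ a, proj L '' X.shadow a ⊆ U a
  inter_nonempty_iff : ∀ a b, a ≠ b → ((U a ∩ U b).Nonempty ↔ (X.whiteheadGraph L).Adj a b)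
  triple_inter : ∀ a b c, a ≠ b → b ≠ c → a ≠ c → U a ∩ U b ∩ U c = ∅

/-- A finite subtree together with a cover associated with it. -/
structure TreeCover {n : ℕ} (L : List (List (Fin n × Bool))) where
  tree : FiniteSubtree n
  cover : AssociatedCover L tree

namespace TreeCover

variable {n : ℕ} {L : List (List (Fin n × Bool))}

/-- `c ≤ d` iff the subtree of `c` is contained in that of `d` and the cover of `d` refines that of
`c`, each `U_b` being contained in `U_a` for the vertex `a` through which one leaves the smaller
tree on the way to `b`. -/
instance : Preorder (TreeCover L) where
  le c d := c.tree.verts ⊆ d.tree.verts ∧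
    ∀ b : d.tree.WhVertex, ∃ a : c.tree.WhVertex,
      c.tree.Beyond a b.1 ∧ d.cover.U b ⊆ c.cover.U a
  le_refl c := ⟨Finset.Subset.refl _, fun b => ⟨b, ⟨.nil, by
    intro z hz
    rw [SimpleGraph.Walk.support_nil, List.mem_singleton] at hz
    exact hz ▸ b.2.1⟩, subset_rfl⟩⟩
  le_trans c d e h₁ h₂ := ⟨h₁.1.trans h₂.1, fun b => by
    obtain ⟨a, ⟨p, hp⟩, ha⟩ := h₂.2 b
    obtain ⟨a', ⟨p', hp'⟩, ha'⟩ := h₁.2 a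
    refine ⟨a', ⟨p'.append p, fun z hz => ?_⟩, ha.trans ha'⟩
    rcases (SimpleGraph.Walk.mem_support_append_iff _ _).1 hz with h | h
    · exact hp' z h
    · exact fun hz' => hp z h (h₁.1 hz')⟩

/-- The refinement map on the index sets of the covers: it sends `b` to the vertex `a` through which
one leaves the smaller tree on the way to `b`. -/
def refineVertex {c d : TreeCover L} (h : c ≤ d) (b : d.tree.WhVertex) : c.tree.WhVertex :=
  (h.2 b).choose

/-- The group of 1-cochains of the nerve of the cover with integer coefficients: an integer for each
pair of distinct members of the cover with nonempty intersection (extended by zero to all pairs).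
The sign `s` is the effect of exchanging the two members of the pair: `s = -1` gives the alternating
cochains of the Čech complex, `s = 1` the labellings of unordered pairs. -/
def cochains (s : ℤˣ) (c : TreeCover L) :
    AddSubgroup (c.tree.WhVertex → c.tree.WhVertex → ℤ) where
  carrier := {f | (∀ a b, f b a = s * f a b) ∧
    ∀ a b, ¬ (a ≠ b ∧ (c.cover.U a ∩ c.cover.U b).Nonempty) → f a b = 0}
  zero_mem' := by simp
  add_mem' := by
    rintro f g ⟨hf, hf'⟩ ⟨hg, hg'⟩
    refine ⟨fun a b => ?_, fun a b h => ?_⟩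
    · simp only [Pi.add_apply, hf a b, hg a b, mul_add]
    · simp only [Pi.add_apply, hf' a b h, hg' a b h, add_zero]
  neg_mem' := by
    rintro f ⟨hf, hf'⟩
    refine ⟨fun a b => ?_, fun a b h => ?_⟩
    · simp only [Pi.neg_apply, hf a b, mul_neg]
    · simp only [Pi.neg_apply, hf' a b h, neg_zero]

open Classical in
/-- The map on 1-cochains induced by refinement: the pull-back along the map of nerves. -/
def refineCochain (s : ℤˣ) {c d : TreeCover L} (h : c ≤ d) : c.cochains s →+ d.cochains s where
  toFun f := ⟨fun b b' =>
      if (d.cover.U b ∩ d.cover.U b').Nonempty then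
        f.1 (refineVertex h b) (refineVertex h b') else 0, by
    refine ⟨fun a b => ?_, fun a b hab => ?_⟩
    · dsimp only
      rw [Set.inter_comm, f.2.1 (refineVertex h a) (refineVertex h b), mul_ite, mul_zero]
    · by_cases hne : (d.cover.U a ∩ d.cover.U b).Nonempty
      · have : a = b := by by_contra hc; exact hab ⟨hc, hne⟩
        dsimp only
        rw [if_pos hne, this]
        exact f.2.2 _ _ (fun h' => h'.1 rfl)
      · exact if_neg hne⟩
  map_zero' := by
    ext b b'
    simp
  map_add' f g := by
    ext b b'
    simp only [AddSubgroup.coe_add, Pi.add_apply]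
    split_ifs <;> simp

end TreeCover

open Classical in
/-- The direct limit of the 1-cochain groups of the covers associated with finite subtrees. -/
abbrev CochainLimit {n : ℕ} (L : List (List (Fin n × Bool))) (s : ℤˣ) : Type :=
  AddCommGroup.DirectLimit (fun c : TreeCover L => c.cochains s)
    (fun _ _ h => TreeCover.refineCochain s h)

open Classical in
/-- An element of the direct limit is supported on the subtree `X` if it is represented by a
1-cochain of a cover associated with `X`. -/
def SupportedOn {n : ℕ} {L : List (List (Fin n × Bool))} {s : ℤˣ} (X : FiniteSubtree n)
    (x : CochainLimit L s) : Prop :=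
  ∃ (c : TreeCover L) (f : c.cochains s), c.tree = X ∧
    AddCommGroup.DirectLimit.of (fun c : TreeCover L => c.cochains s)
      (fun _ _ h => TreeCover.refineCochain s h) c f = x

/-- A list of words as data for an algorithm: the basis elements are numbered by naturals. -/
def encodeWords {n : ℕ} (L : List (List (Fin n × Bool))) : List (List (ℕ × Bool)) :=
  L.map fun w => w.map fun l => (l.1.val, l.2)

end DecompositionCohomology

end

open DecompositionCohomology

open Filter Topology
open DecompositionCohomology

namespace DecompositionCohomology

variable {n : ℕ}

/-! ## Words and half-trees -/

/-! A 1-cochain of a cover associated with `X` is a finite sum of cochains concentrated on single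
edges of the Whitehead graph, so it is enough to move an edge cochain to a small subtree. An edge
from `b` to `a` is carried by a line of the pattern that enters `X` from `b` and leaves it through
`a`. If this crossing is long, only its first piece is needed, because the pattern is rigid: all
lines have periodic steps with the common period `P`, the factorial of the total length of the
words, and two such lines that share a segment of `P` steps coincide (`IsPeriodicLine.ends_eq`).

So let `Y` consist of the first `min(crossing length, P)` steps of the crossing, and let `a'`, `b'`
be the vertices through which the line leaves `Y`. Any line joining shadows of `X` beyond `a'` and
beyond `b'` runs along all of `Y`. Then either `Y` is the whole crossing or the lines are equal, and
in both cases the edge at `X` is the given one (`FiniteSubtree.exists_small_subtree`). Hence the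
edge cochain at `Y` pulls back to the edge cochain at `X`. As `Y` has at most `P + 1` vertices, `P +
2` is a strict bound.

To compare the two classes in the direct limit, some cover associated with `X` must refine both
given covers (`exists_associatedCover`). This rests on two facts: the fibres of the projection have
at most two points (`proj_eq_iff`), and only finitely many lines cross a finite subtree
(`finite_crossingEnds`). -/

theorem adj_iff_exists_letter (x y : FreeGroup (Fin n)) :
    (cayleyTree n).Adj x y ↔ ∃ t : Fin n × Bool, y = x * FreeGroup.mk [t] := by
  rw [SimpleGraph.mulCayley_adj]
  constructor
  · rintro ⟨-, ⟨i, hi⟩ | ⟨i, hi⟩⟩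
    · exact ⟨(i, true), by rw [← FreeGroup.of.eq_1, hi]; group⟩
    · refine ⟨(i, false), ?_⟩
      have : FreeGroup.mk [(i, false)] = (FreeGroup.of i)⁻¹ := rfl
      rw [this, hi]; group
  · rintro ⟨⟨i, b⟩, rfl⟩
    refine ⟨fun h => ?_, ?_⟩
    · have h1 : FreeGroup.mk [(i, b)] = 1 := by simpa using h.symm
      have h2 := congrArg FreeGroup.toWord h1
      simp [FreeGroup.toWord_mk] at h2
    · cases b
      · right; exact ⟨i, by
          have : FreeGroup.mk [(i, false)] = (FreeGroup.of i)⁻¹ := rfl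
          rw [this]; group⟩
      · left; exact ⟨i, by
          have : FreeGroup.mk [(i, true)] = FreeGroup.of i := rfl
          rw [this]; group⟩

theorem adj_mul_letter (x : FreeGroup (Fin n)) (t : Fin n × Bool) :
    (cayleyTree n).Adj x (x * FreeGroup.mk [t]) :=
  (adj_iff_exists_letter _ _).2 ⟨t, rfl⟩

/-- Right multiplication by a letter either cancels the last letter of the reduced word or appends
the letter to it. -/
theorem toWord_mul_letter (A : FreeGroup (Fin n)) (t : Fin n × Bool) :
    A.toWord = (A * FreeGroup.mk [t]).toWord ++ [(t.1, !t.2)] ∨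
      (A * FreeGroup.mk [t]).toWord = A.toWord ++ [t] := by
  have hred := FreeGroup.isReduced_toWord (x := A)
  have hA : A * FreeGroup.mk [t] = FreeGroup.mk (A.toWord ++ [t]) := by
    rw [← FreeGroup.mul_mk, FreeGroup.mk_toWord]
  rw [hA, FreeGroup.toWord_mk]
  rcases List.eq_nil_or_concat A.toWord with h | ⟨r, u, h⟩
  · right; rw [h]; rfl
  · rw [List.concat_eq_append] at h
    rw [h] at hred ⊢
    by_cases hu : u = (t.1, !t.2)
    · left
      subst hu
      have h1 : FreeGroup.mk (r ++ [(t.1, !t.2)] ++ [t]) = FreeGroup.mk r := by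
        apply Quot.sound
        have := FreeGroup.Red.Step.not (L₁ := r) (L₂ := []) (x := t.1) (b := !t.2)
        simpa using this
      rw [← FreeGroup.toWord_mk, h1, FreeGroup.toWord_mk,
        (hred.infix ⟨[], [(t.1, !t.2)], by simp⟩ : FreeGroup.IsReduced r).reduce_eq]
    · right
      apply FreeGroup.IsReduced.reduce_eq
      refine FreeGroup.IsReduced.append_overlap (L₁ := r) (L₂ := [u]) (L₃ := [t]) hred ?_ (by simp)
      refine FreeGroup.isReduced_cons_cons.2 ⟨fun h1 => ?_, FreeGroup.IsReduced.singleton⟩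
      by_contra h2
      refine hu (Prod.ext h1 ?_)
      revert h2
      cases u.2 <;> cases t.2 <;> simp

/-- The vertices that are separated from `x` by the edge from `x` to `y`. -/
def HalfTree (x y z : FreeGroup (Fin n)) : Prop :=
  (x⁻¹ * y).toWord <+: (x⁻¹ * z).toWord

namespace HalfTree

variable {x y y' z z' : FreeGroup (Fin n)}

theorem self (x y : FreeGroup (Fin n)) : HalfTree x y y := List.prefix_refl _

theorem toWord_letter (t : Fin n × Bool) : (FreeGroup.mk [t]).toWord = [t] := rfl

theorem not_base (h : (cayleyTree n).Adj x y) : ¬ HalfTree x y x := by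
  obtain ⟨t, rfl⟩ := (adj_iff_exists_letter _ _).1 h
  rw [HalfTree, inv_mul_cancel_left, inv_mul_cancel, toWord_letter]
  simp

theorem eq_of_mem (h : (cayleyTree n).Adj x y) (h' : (cayleyTree n).Adj x y')
    (hz : HalfTree x y z) (hz' : HalfTree x y' z) : y = y' := by
  obtain ⟨t, rfl⟩ := (adj_iff_exists_letter _ _).1 h
  obtain ⟨t', rfl⟩ := (adj_iff_exists_letter _ _).1 h'
  rw [HalfTree, inv_mul_cancel_left, toWord_letter] at hz hz'
  obtain ⟨r, hr⟩ := hz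
  obtain ⟨r', hr'⟩ := hz'
  rw [← hr'] at hr
  have : t = t' := by simpa using (List.cons.inj hr).1
  rw [this]

/-- The edge from `x` to `y` is the only edge that leaves the half-tree. -/
theorem eq_of_leave (h : (cayleyTree n).Adj x y) (hadj : (cayleyTree n).Adj z z')
    (hz : HalfTree x y z) (hz' : ¬ HalfTree x y z') : z = y ∧ z' = x := by
  obtain ⟨s, rfl⟩ := (adj_iff_exists_letter _ _).1 h
  obtain ⟨t, rfl⟩ := (adj_iff_exists_letter _ _).1 hadj
  rw [HalfTree, inv_mul_cancel_left, toWord_letter] at hz hz'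
  rw [← mul_assoc] at hz'
  rcases toWord_mul_letter (x⁻¹ * z) t with h1 | h1
  · rw [h1] at hz
    have hnil : (x⁻¹ * z * FreeGroup.mk [t]).toWord = [] := by
      rcases hw : (x⁻¹ * z * FreeGroup.mk [t]).toWord with _ | ⟨u, r⟩
      · rfl
      · exfalso
        rw [hw] at hz hz'
        rw [List.cons_append, List.cons_prefix_cons] at hz
        exact hz' (by simp [hz.1])
    rw [hnil] at h1 hz
    have h2 := FreeGroup.toWord_eq_nil_iff.1 hnil
    have h3 : x⁻¹ * z = FreeGroup.mk [s] := by
      apply FreeGroup.toWord_injective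
      rw [h1, toWord_letter]
      simp only [List.nil_append, List.cons_prefix_cons] at hz ⊢
      rw [hz.1]
    refine ⟨by rw [← h3]; group, ?_⟩
    rw [mul_assoc] at h2
    exact (inv_mul_eq_one.1 h2).symm
  · exact absurd (hz.trans ⟨[t], h1.symm⟩) hz'

theorem eq_of_enter (h : (cayleyTree n).Adj x y) (hadj : (cayleyTree n).Adj z z')
    (hz : ¬ HalfTree x y z) (hz' : HalfTree x y z') : z = x ∧ z' = y :=
  (eq_of_leave h hadj.symm hz' hz).symm

/-- Seen from `x`, the word of `z` is the letter of the edge followed by some `r`; seen from `y` it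
is `r`. If `r` began with the inverse letter, the first word would not be reduced. -/
theorem not_symm (h : (cayleyTree n).Adj x y) (hz : HalfTree x y z) : ¬ HalfTree y x z := by
  intro hz'
  obtain ⟨⟨i, b⟩, rfl⟩ := (adj_iff_exists_letter _ _).1 h
  have e1 : (x * FreeGroup.mk [(i, b)])⁻¹ * x = FreeGroup.mk [(i, !b)] := by
    rw [mul_inv_rev, FreeGroup.inv_mk]; simp [FreeGroup.invRev]
  rw [HalfTree, inv_mul_cancel_left, toWord_letter] at hz
  rw [HalfTree, e1, toWord_letter] at hz'
  obtain ⟨r, hr⟩ := hz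
  have hred : FreeGroup.IsReduced ([(i, b)] ++ r) := hr ▸ FreeGroup.isReduced_toWord
  have e2 : (x * FreeGroup.mk [(i, b)])⁻¹ * z = FreeGroup.mk r := by
    have : x⁻¹ * z = FreeGroup.mk [(i, b)] * FreeGroup.mk r := by
      rw [FreeGroup.mul_mk, hr, FreeGroup.mk_toWord]
    rw [mul_inv_rev, mul_assoc, this]; group
  rw [e2, FreeGroup.toWord_mk,
    (hred.infix ⟨[(i, b)], [], by simp⟩ : FreeGroup.IsReduced r).reduce_eq] at hz'
  obtain ⟨r', rfl⟩ := hz'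
  simp only [List.cons_append, List.nil_append, FreeGroup.isReduced_cons_cons] at hred
  simpa using hred.1 trivial

/-- A walk that enters a half-tree passes through its edge. -/
theorem exists_dart_of_walk (h : (cayleyTree n).Adj x y) :
    ∀ {u v : FreeGroup (Fin n)} (p : (cayleyTree n).Walk u v), ¬ HalfTree x y u → HalfTree x y v →
      x ∈ p.support ∧ y ∈ p.support
  | _, _, .nil, hu, hv => absurd hv hu
  | u, v, .cons (v := w) ha p, hu, hv => by
    by_cases hw : HalfTree x y w
    · obtain ⟨rfl, rfl⟩ := eq_of_enter h ha hu hw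
      simp
    · obtain ⟨h1, h2⟩ := exists_dart_of_walk h p hw hv
      simp [h1, h2]

/-- The half-tree beyond an edge pointing away from the identity consists of the words with the
corresponding prefix. -/
theorem iff_prefix {p : List (Fin n × Bool)} {s : Fin n × Bool}
    (hp : FreeGroup.IsReduced (p ++ [s])) :
    HalfTree (FreeGroup.mk p) (FreeGroup.mk (p ++ [s])) z ↔ p ++ [s] <+: z.toWord := by
  have hadj : (cayleyTree n).Adj (FreeGroup.mk p) (FreeGroup.mk (p ++ [s])) :=
    (adj_iff_exists_letter _ _).2 ⟨s, by rw [FreeGroup.mul_mk]⟩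
  have e1 : (FreeGroup.mk p)⁻¹ * FreeGroup.mk (p ++ [s]) = FreeGroup.mk [s] := by
    rw [← FreeGroup.mul_mk]; group
  constructor
  · intro hz
    generalize hk : z.toWord.length = k
    induction k generalizing z with
    | zero =>
      exfalso
      rw [List.length_eq_zero_iff, FreeGroup.toWord_eq_nil_iff] at hk
      subst hk
      rw [HalfTree, e1, toWord_letter, mul_one, FreeGroup.toWord_inv, FreeGroup.toWord_mk,
        (hp.infix ⟨[], [s], by simp⟩ : FreeGroup.IsReduced p).reduce_eq] at hz
      rcases List.eq_nil_or_concat p with h | ⟨r, u, h⟩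
      · subst h; simp [FreeGroup.invRev] at hz
      · rw [List.concat_eq_append] at h
        subst h
        simp only [FreeGroup.invRev, List.map_append, List.reverse_append, List.map_cons,
          List.map_nil, List.reverse_singleton, List.cons_append, List.cons_prefix_cons] at hz
        have h2 : FreeGroup.IsReduced [u, s] := hp.infix ⟨r, [], by simp⟩
        rw [FreeGroup.isReduced_cons_cons, hz.1] at h2
        simpa using h2.1 rfl
    | succ k ih =>
      rcases List.eq_nil_or_concat z.toWord with h | ⟨r, u, h⟩
      · simp [h] at hk
      rw [List.concat_eq_append] at h
      have hr : FreeGroup.IsReduced r :=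
        FreeGroup.isReduced_toWord.infix (L₂ := z.toWord) ⟨[], [u], by simp [h]⟩
      have hz0 : (FreeGroup.mk r).toWord = r := by rw [FreeGroup.toWord_mk, hr.reduce_eq]
      have hzr : z = FreeGroup.mk r * FreeGroup.mk [u] := by
        rw [FreeGroup.mul_mk, ← h, FreeGroup.mk_toWord]
      by_cases hin : HalfTree (FreeGroup.mk p) (FreeGroup.mk (p ++ [s])) (FreeGroup.mk r)
      · have := ih hin (by rw [hz0]; rw [h] at hk; simpa using hk)
        rw [hz0] at this
        rw [h]
        exact this.trans ⟨[u], rfl⟩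
      -- The last letter of `z` enters the half-tree, so it traverses the edge itself and `z` is its
      -- far end.
      · obtain ⟨-, h2⟩ := eq_of_enter hadj (hzr ▸ adj_mul_letter _ u) hin hz
        rw [h2, FreeGroup.toWord_mk, hp.reduce_eq]
  · rintro ⟨r, hr⟩
    have hred : FreeGroup.IsReduced ([s] ++ r) :=
      FreeGroup.isReduced_toWord.infix (L₂ := z.toWord) ⟨p, [], by simp [← hr]⟩
    have e2 : (FreeGroup.mk p)⁻¹ * z = FreeGroup.mk ([s] ++ r) := by
      rw [← FreeGroup.mk_toWord (x := z), ← hr, List.append_assoc, ← FreeGroup.mul_mk]; group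
    rw [HalfTree, e1, e2, toWord_letter, FreeGroup.toWord_mk, hred.reduce_eq]
    exact ⟨r, rfl⟩

end HalfTree

/-! ## Geodesic lines -/

/-- A path without backtracking, that is, a bi-infinite geodesic of the Cayley tree. -/
structure IsGeodesic (γ : ℤ → FreeGroup (Fin n)) : Prop where
  adj : ∀ i, (cayleyTree n).Adj (γ i) (γ (i + 1))
  ne : ∀ i, γ i ≠ γ (i + 2)

/-- The steps of the path `γ` are periodic with period `P`. -/
def HasPeriod (P : ℕ) (γ : ℤ → FreeGroup (Fin n)) : Prop :=
  ∀ i, (γ (i + P))⁻¹ * γ (i + P + 1) = (γ i)⁻¹ * γ (i + 1)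

namespace HasPeriod

variable {γ : ℤ → FreeGroup (Fin n)} {P : ℕ}

theorem reverse (h : HasPeriod P γ) : HasPeriod P fun i => γ (-i) := fun i => by
  have := h (-(i + P + 1))
  rw [show -(i + P + 1) + (P : ℤ) = -(i + 1) by ring, show -(i + 1) + 1 = -i by ring,
    show -(i + P + 1) + 1 = -(i + P) by ring] at this
  have h2 := congrArg (·⁻¹) this
  simpa using h2.symm

theorem shift (h : HasPeriod P γ) (c : ℤ) : HasPeriod P fun i => γ (i + c) := fun i => by
  have := h (i + c)
  rwa [show i + c + P = i + P + c by ring, show i + P + c + 1 = i + P + 1 + c by ring,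
    show i + c + 1 = i + 1 + c by ring] at this

theorem mul (h : HasPeriod P γ) (k : ℕ) : HasPeriod (P * k) γ := by
  induction k with
  | zero => intro i; simp
  | succ k ih =>
    intro i
    rw [← ih i, ← h (i + (P * k : ℕ))]
    rw [show i + ((P * (k + 1) : ℕ) : ℤ) = i + (P * k : ℕ) + P by push_cast; ring]

theorem of_dvd {Q : ℕ} (h : HasPeriod P γ) (hd : P ∣ Q) : HasPeriod Q γ := by
  obtain ⟨k, rfl⟩ := hd
  exact h.mul k

theorem periodic (h : HasPeriod P γ) :
    Function.Periodic (fun i => (γ i)⁻¹ * γ (i + 1)) (P : ℤ) := h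

end HasPeriod

namespace IsGeodesic

variable {γ γ' : ℤ → FreeGroup (Fin n)}

theorem reverse (h : IsGeodesic γ) : IsGeodesic fun i => γ (-i) where
  adj i := by
    have := (h.adj (-(i + 1))).symm
    rwa [show -(i + 1) + 1 = -i by ring] at this
  ne i := by
    have := (h.ne (-(i + 2))).symm
    rwa [show -(i + 2) + 2 = -i by ring] at this

theorem shift (h : IsGeodesic γ) (c : ℤ) : IsGeodesic fun i => γ (i + c) where
  adj i := by
    have := h.adj (i + c)
    rwa [show i + c + 1 = i + 1 + c by ring] at this
  ne i := by
    have := h.ne (i + c)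
    rwa [show i + c + 2 = i + 2 + c by ring] at this

/-- A first step out of the half-tree would go from `γ (i + 1)` back to `γ i`. Done at once, this is
backtracking; done later, the path has returned to `γ (i + 1)`, although by induction it stays
beyond the next edge. -/
theorem halfTree_add (h : IsGeodesic γ) (k : ℕ) :
    ∀ i, HalfTree (γ i) (γ (i + 1)) (γ (i + 1 + k)) := by
  induction k using Nat.strong_induction_on with
  | _ k ih =>
    rcases k with _ | k
    · intro i; simpa using HalfTree.self _ _
    intro i
    by_contra hc
    have hadj := h.adj (i + 1 + k)
    rw [show i + 1 + (k : ℤ) + 1 = i + 1 + (k + 1 : ℕ) by push_cast; ring] at hadj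
    obtain ⟨h1, h2⟩ := HalfTree.eq_of_leave (h.adj i) hadj (ih k (by omega) i) hc
    rcases k with _ | k
    · refine h.ne i ?_
      rw [← h2]; congr 1; push_cast; ring
    · refine HalfTree.not_base (h.adj (i + 1)) ?_
      have := ih k (by omega) (i + 1)
      rwa [show i + 1 + 1 + (k : ℤ) = i + 1 + (k + 1 : ℕ) by push_cast; ring, h1] at this

theorem halfTree_of_lt (h : IsGeodesic γ) {i j : ℤ} (hij : i < j) :
    HalfTree (γ i) (γ (i + 1)) (γ j) := by
  have := h.halfTree_add (j - i - 1).toNat i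
  rwa [show i + 1 + ((j - i - 1).toNat : ℤ) = j by omega] at this

theorem not_halfTree_of_le (h : IsGeodesic γ) {i j : ℤ} (hij : j ≤ i) :
    ¬ HalfTree (γ i) (γ (i + 1)) (γ j) := by
  have := h.reverse.halfTree_of_lt (i := -(i + 1)) (j := -j) (by omega)
  simp only [neg_neg] at this
  rw [show -(-(i + 1) + 1) = i by ring] at this
  exact HalfTree.not_symm (h.adj i).symm this

theorem injective (h : IsGeodesic γ) : Function.Injective γ := fun i j hij => by
  rcases lt_trichotomy i j with hlt | heq | hlt
  · exact absurd (hij ▸ h.halfTree_of_lt hlt) (HalfTree.not_base (h.adj i))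
  · exact heq
  · exact absurd (hij ▸ h.halfTree_of_lt hlt) (HalfTree.not_base (h.adj j))

/-- Two geodesics with two common points, passed in the same order, share the segment between
them. -/
theorem eq_of_common (h : IsGeodesic γ) (h' : IsGeodesic γ') (m : ℕ) :
    ∀ {i i' j' : ℤ}, γ i = γ' i' → γ (i + m) = γ' j' → i' ≤ j' →
      ∀ k : ℕ, k ≤ m → γ (i + k) = γ' (i' + k) := by
  induction m with
  | zero =>
    intro i i' j' hi _ _ k hk
    obtain rfl : k = 0 := by omega
    simpa using hi
  | succ m ih =>
    intro i i' j' hi hj hle k hk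
    rcases hle.eq_or_lt with rfl | hlt
    · exfalso
      have := h.injective (hi.trans hj.symm)
      push_cast at this
      omega
    -- Both next vertices are the neighbour of `γ i` in the direction of the far common point.
    have h1 : HalfTree (γ i) (γ (i + 1)) (γ' j') := by
      rw [← hj]; exact h.halfTree_of_lt (by push_cast; omega)
    have h2 : HalfTree (γ i) (γ' (i' + 1)) (γ' j') := by
      rw [hi]; exact h'.halfTree_of_lt hlt
    have h3 := HalfTree.eq_of_mem (h.adj i) (by rw [hi]; exact h'.adj i') h1 h2
    rcases k with _ | k
    · simpa using hi
    · have := ih h3 (j' := j') (by rw [← hj]; congr 1; push_cast; ring) (by omega) k (by omega)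
      rw [show i + ((k + 1 : ℕ) : ℤ) = i + 1 + k by push_cast; ring,
        show i' + ((k + 1 : ℕ) : ℤ) = i' + 1 + k by push_cast; ring, this]

end IsGeodesic

/-- Two paths with a common period that share a segment as long as that period coincide. -/
theorem HasPeriod.eq_of_segment {γ γ' : ℤ → FreeGroup (Fin n)} {P : ℕ} (hP : 0 < P)
    (h : HasPeriod P γ) (h' : HasPeriod P γ') {i i' : ℤ}
    (heq : ∀ k : ℕ, k ≤ P → γ (i + k) = γ' (i' + k)) (k : ℤ) : γ (i + k) = γ' (i' + k) := by
  -- Modulo the period, each step can be moved into the shared segment.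
  have hstep : ∀ k : ℤ, (γ (i + k))⁻¹ * γ (i + k + 1) = (γ' (i' + k))⁻¹ * γ' (i' + k + 1) := by
    intro k
    have hP' : (0 : ℤ) < P := by exact_mod_cast hP
    have hm0 := Int.emod_nonneg k hP'.ne'
    have hm1 := Int.emod_lt_of_pos k hP'
    have e := Int.mul_ediv_add_emod k P
    have p1 := h.periodic.int_mul (k / P) (i + k % P)
    have p2 := h'.periodic.int_mul (k / P) (i' + k % P)
    rw [Int.cast_id] at p1 p2
    rw [show i + k % P + (k / P : ℤ) * (P : ℤ) = i + k by linarith] at p1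
    rw [show i' + k % P + (k / P : ℤ) * (P : ℤ) = i' + k by linarith] at p2
    rw [p1, p2]
    obtain ⟨m, hm⟩ := Int.eq_ofNat_of_zero_le hm0
    rw [hm] at hm1 ⊢
    have q1 := heq m (by omega)
    have q2 := heq (m + 1) (by omega)
    push_cast at q2
    rw [q1, add_assoc, q2, add_assoc]
  induction k using Int.induction_on with
  | zero => simpa using heq 0 (by omega)
  | succ k ih =>
    have := hstep k
    rw [ih] at this
    rw [← add_assoc, ← add_assoc]
    exact mul_left_cancel this
  | pred k ih =>
    have := hstep (-k - 1)
    rw [show i + (-(k : ℤ) - 1) + 1 = i + -k by ring,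
      show i' + (-(k : ℤ) - 1) + 1 = i' + -k by ring, ih] at this
    exact inv_injective (mul_right_cancel this)

/-! ## Boundary points -/

namespace Boundary

theorem initial_succ (ξ : Boundary n) (k : ℕ) : ξ.initial (k + 1) = ξ.initial k ++ [ξ.1 k] := by
  simp [initial, List.range_succ]

@[simp]
theorem length_initial (ξ : Boundary n) (k : ℕ) : (ξ.initial k).length = k := by
  simp [initial]

theorem initial_prefix (ξ : Boundary n) {k m : ℕ} (h : k ≤ m) : ξ.initial k <+: ξ.initial m := by
  induction m, h using Nat.le_induction with
  | base => exact List.prefix_refl _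
  | succ m _ ih => exact ih.trans ⟨[ξ.1 m], (ξ.initial_succ m).symm⟩

theorem isReduced_initial (ξ : Boundary n) (k : ℕ) : FreeGroup.IsReduced (ξ.initial k) := by
  induction k with
  | zero => exact FreeGroup.IsReduced.nil
  | succ k ih =>
    rcases k with _ | k
    · exact FreeGroup.IsReduced.singleton
    rw [initial_succ, initial_succ]
    rw [initial_succ] at ih
    refine FreeGroup.IsReduced.append_overlap ih ?_ (by simp)
    refine FreeGroup.isReduced_cons_cons.2 ⟨fun h1 => ?_, FreeGroup.IsReduced.singleton⟩
    by_contra h2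
    refine ξ.2 k (Prod.ext h1.symm ?_)
    revert h2
    cases (ξ.1 k).2 <;> cases (ξ.1 (k + 1)).2 <;> simp

theorem toWord_ray (ξ : Boundary n) (k : ℕ) : (ξ.ray k).toWord = ξ.initial k := by
  rw [ray, FreeGroup.toWord_mk, (ξ.isReduced_initial k).reduce_eq]

theorem ext_initial {ξ η : Boundary n} (h : ∀ m, ξ.initial m = η.initial m) : ξ = η := by
  refine Subtype.ext (funext fun k => ?_)
  have := h (k + 1)
  rw [initial_succ, initial_succ, h k] at this
  simpa using this

theorem initial_eq_of_prefix {ξ η : Boundary n} {m : ℕ} {w : List (Fin n × Bool)}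
    (h : ξ.initial m <+: w) (h' : η.initial m <+: w) : ξ.initial m = η.initial m := by
  rw [List.prefix_iff_eq_take.1 h, List.prefix_iff_eq_take.1 h', length_initial, length_initial]

theorem ray_adj (ξ : Boundary n) (k : ℕ) : (cayleyTree n).Adj (ξ.ray k) (ξ.ray (k + 1)) :=
  (adj_iff_exists_letter _ _).2 ⟨ξ.1 k, by rw [ray, ray, initial_succ, FreeGroup.mul_mk]⟩

theorem halfTree_ray_iff (ξ : Boundary n) (k : ℕ) (z : FreeGroup (Fin n)) :
    HalfTree (ξ.ray k) (ξ.ray (k + 1)) z ↔ ξ.initial (k + 1) <+: z.toWord := by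
  have := ξ.isReduced_initial (k + 1)
  rw [initial_succ] at this
  rw [ray, ray, initial_succ]
  exact HalfTree.iff_prefix this

/-- The boundary point `ξ` is the end of the path `γ` at `+∞`. -/
def IsEndOf (ξ : Boundary n) (γ : ℤ → FreeGroup (Fin n)) : Prop :=
  ∀ m, ∀ᶠ k in atTop, ξ.initial m <+: (γ k).toWord

theorem IsEndOf.unique {ξ η : Boundary n} {γ : ℤ → FreeGroup (Fin n)} (h : ξ.IsEndOf γ)
    (h' : η.IsEndOf γ) : ξ = η :=
  ext_initial fun m => by
    obtain ⟨k, hk, hk'⟩ := ((h m).and (h' m)).exists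
    exact initial_eq_of_prefix hk hk'

theorem IsEndOf.shift {ξ : Boundary n} {γ : ℤ → FreeGroup (Fin n)} (h : ξ.IsEndOf γ) (c : ℤ) :
    ξ.IsEndOf fun i => γ (i + c) := fun m =>
  (tendsto_atTop_add_const_right atTop c tendsto_id).eventually (h m)

/-- A geodesic that ends in `ξ` passes through all but finitely many edges of the ray to `ξ`. -/
theorem IsEndOf.exists_edge {ξ : Boundary n} {γ : ℤ → FreeGroup (Fin n)} (hγ : IsGeodesic γ)
    (h : ξ.IsEndOf γ) {m : ℕ} (hm : (γ 0).toWord.length ≤ m) :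
    ∃ j, γ j = ξ.ray m ∧ γ (j + 1) = ξ.ray (m + 1) := by
  obtain ⟨k, hk, hk0⟩ := ((h (m + 1)).and (eventually_ge_atTop 0)).exists
  obtain ⟨k, rfl⟩ := Int.eq_ofNat_of_zero_le hk0
  rw [← halfTree_ray_iff] at hk
  clear hk0
  -- The word of `γ 0` is too short for `γ 0` to lie beyond the edge, so `γ` must cross the edge at
  -- some time between `0` and `k`.
  induction k with
  | zero =>
    rw [halfTree_ray_iff] at hk
    have := hk.length_le
    simp at this
    omega
  | succ k ih =>
    by_cases hk' : HalfTree (ξ.ray m) (ξ.ray (m + 1)) (γ k)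
    · exact ih hk'
    · have := HalfTree.eq_of_enter (ξ.ray_adj m) (hγ.adj k) hk' (by exact_mod_cast hk)
      exact ⟨k, this⟩

/-- A geodesic that ends in `ξ` eventually runs along the ray to `ξ`. -/
theorem IsEndOf.exists_ray {ξ : Boundary n} {γ : ℤ → FreeGroup (Fin n)} (hγ : IsGeodesic γ)
    (h : ξ.IsEndOf γ) {m : ℕ} (hm : (γ 0).toWord.length ≤ m) :
    ∃ i, ∀ k : ℕ, γ (i + k) = ξ.ray (m + k) := by
  obtain ⟨i, hi, -⟩ := h.exists_edge hγ hm
  refine ⟨i, fun k => ?_⟩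
  induction k with
  | zero => simpa using hi
  | succ k ih =>
    obtain ⟨j, hj, hj1⟩ := h.exists_edge hγ (m := m + k) (by omega)
    obtain rfl := hγ.injective (ih.trans hj.symm)
    rw [← add_assoc m, ← hj1]
    congr 1; push_cast; ring

end Boundary

/-- `γ` is a geodesic line with periodic steps that runs from `η` to `ξ`. -/
structure IsPeriodicLine (P : ℕ) (γ : ℤ → FreeGroup (Fin n)) (ξ η : Boundary n) : Prop where
  geodesic : IsGeodesic γ
  period : HasPeriod P γ
  pos_end : ξ.IsEndOf γ
  neg_end : η.IsEndOf fun i => γ (-i)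

namespace IsPeriodicLine

variable {P : ℕ} {γ γ' : ℤ → FreeGroup (Fin n)} {ξ η ξ' η' : Boundary n}

theorem reverse (h : IsPeriodicLine P γ ξ η) : IsPeriodicLine P (fun i => γ (-i)) η ξ where
  geodesic := h.geodesic.reverse
  period := h.period.reverse
  pos_end := h.neg_end
  neg_end := by simpa using h.pos_end

theorem shift (h : IsPeriodicLine P γ ξ η) (c : ℤ) :
    IsPeriodicLine P (fun i => γ (i + c)) ξ η where
  geodesic := h.geodesic.shift c
  period := h.period.shift c
  pos_end := h.pos_end.shift c
  neg_end := by
    have := h.neg_end.shift (-c)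
    simpa [neg_add, add_comm] using this

/-- Lines that share two points at distance `P` coincide. -/
theorem ends_eq (hP : 0 < P) (h : IsPeriodicLine P γ ξ η) (h' : IsPeriodicLine P γ' ξ' η')
    {i i' j' : ℤ} (hi : γ i = γ' i') (hj : γ (i + P) = γ' j') (hle : i' ≤ j') :
    ξ = ξ' ∧ η = η' := by
  have key := h.period.eq_of_segment hP h'.period
    (h.geodesic.eq_of_common h'.geodesic P hi hj hle)
  have hγ : (fun k => γ (k + i)) = fun k => γ' (k + i') := by
    funext k; rw [add_comm, key, add_comm]
  have s := h.shift i
  have s' := h'.shift i'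
  rw [hγ] at s
  exact ⟨s.pos_end.unique s'.pos_end, s.neg_end.unique s'.neg_end⟩

/-- A boundary point is the end of at most one line. -/
theorem right_unique (hP : 0 < P) (h : IsPeriodicLine P γ ξ η) (h' : IsPeriodicLine P γ' ξ η') :
    η = η' := by
  obtain ⟨i, hi⟩ := h.pos_end.exists_ray h.geodesic (m := max (γ 0).toWord.length
    (γ' 0).toWord.length) (le_max_left _ _)
  obtain ⟨i', hi'⟩ := h'.pos_end.exists_ray h'.geodesic (m := max (γ 0).toWord.length
    (γ' 0).toWord.length) (le_max_right _ _)
  have h0 := (hi 0).trans (hi' 0).symm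
  simp only [Nat.cast_zero, add_zero] at h0
  exact (h.ends_eq hP h' h0 ((hi P).trans (hi' P).symm) (by omega)).2

end IsPeriodicLine

/-! ## The lines of a line pattern -/

/-- Each letter of `w` cancels at most one letter at the end of the reduced word. -/
theorem take_prefix_mul_mk (w : List (Fin n × Bool)) :
    ∀ {X : List (Fin n × Bool)} {A : FreeGroup (Fin n)}, X <+: A.toWord →
      X.take (X.length - w.length) <+: (A * FreeGroup.mk w).toWord := by
  induction w with
  | nil => intro X A h; simpa [← FreeGroup.one_eq_mk] using h
  | cons t w ih =>
    intro X A h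
    have h1 : X.take (X.length - 1) <+: (A * FreeGroup.mk [t]).toWord := by
      rcases toWord_mul_letter A t with e | e
      · rcases List.prefix_concat_iff.1 (e ▸ h) with h2 | h2
        · rw [h2]; simp
        · exact (List.take_prefix _ _).trans h2
      · rw [e]; exact (List.take_prefix _ _).trans (h.trans ⟨_, rfl⟩)
    have h2 := ih h1
    rw [mul_assoc, FreeGroup.mul_mk, List.take_take] at h2
    have e : min ((X.take (X.length - 1)).length - w.length) (X.length - 1)
        = X.length - (t :: w).length := by
      simp only [List.length_take, List.length_cons]; omega
    rw [e] at h2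
    exact h2

/-- A path that stays at bounded distance from a convergent sequence has the same limit. -/
theorem Boundary.IsLimitOf.isEndOf {ξ : Boundary n} {u : ℕ → FreeGroup (Fin n)}
    (h : ξ.IsLimitOf u) {γ : ℤ → FreeGroup (Fin n)} {φ : ℤ → ℕ} (hφ : Tendsto φ atTop atTop)
    (B : ℕ) (hB : ∀ᶠ i in atTop, ∃ w : List (Fin n × Bool), w.length ≤ B ∧
      γ i = u (φ i) * FreeGroup.mk w) : ξ.IsEndOf γ := by
  intro m
  filter_upwards [hφ.eventually (h (m + B)), hB] with i hi ⟨w, hw, e⟩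
  have h1 := take_prefix_mul_mk w hi
  rw [← e, length_initial] at h1
  refine List.IsPrefix.trans ?_ h1
  rw [List.prefix_take_iff]
  refine ⟨ξ.initial_prefix (by omega), by rw [length_initial]; omega⟩

/-- Write `A = p u p⁻¹` with `u` cyclically reduced. The path that starts at `g p` and reads the
bi-infinite word `…uuu…` does not backtrack and has period `u.length`. It stays at bounded distance
from the points `g A ^ q`, hence has the same ends. -/
theorem isPeriodicLine_of_limits {P : ℕ} {A g : FreeGroup (Fin n)} {ξ η : Boundary n}
    (hP : ∀ k, 0 < k → k ≤ A.toWord.length → k ∣ P)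
    (hξ : ξ.IsLimitOf fun k => g * A ^ k) (hη : η.IsLimitOf fun k => g * A⁻¹ ^ k) :
    ∃ γ, IsPeriodicLine P γ ξ η := by
  set u := FreeGroup.reduceCyclically A.toWord with hu
  set p := FreeGroup.reduceCyclically.conjugator A.toWord with hp
  have hcyc : FreeGroup.IsCyclicallyReduced u :=
    FreeGroup.reduceCyclically.isCyclicallyReduced FreeGroup.isReduced_toWord
  have hconj := FreeGroup.reduceCyclically.conj_conjugator_reduceCyclically A.toWord
  rw [← hu, ← hp] at hconj
  have hA : A = FreeGroup.mk p * FreeGroup.mk u * (FreeGroup.mk p)⁻¹ := by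
    rw [FreeGroup.inv_mk, FreeGroup.mul_mk, FreeGroup.mul_mk, hconj, FreeGroup.mk_toWord]
  -- If `u` were empty, the sequence would be constant, and a constant sequence has no limit on the
  -- boundary.
  have hc : 0 < u.length := by
    rw [List.length_pos_iff]
    intro h0
    have hA1 : A = 1 := by rw [hA, h0, ← FreeGroup.one_eq_mk]; group
    obtain ⟨k, hk⟩ := (hξ (g.toWord.length + 1)).exists
    simp only [hA1, one_pow, mul_one] at hk
    have := hk.length_le
    rw [Boundary.length_initial] at this
    omega
  have hle : u.length ≤ A.toWord.length := by
    have := congrArg List.length hconj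
    simp only [List.length_append] at this
    omega
  set c := u.length with hcdef
  have hc' : (0 : ℤ) < c := by exact_mod_cast hc
  have hmod : ∀ i : ℤ, (i % c).toNat < u.length := fun i => by
    have := Int.emod_nonneg i hc'.ne'
    have := Int.emod_lt_of_pos i hc'
    omega
  let l : ℤ → Fin n × Bool := fun i => u[(i % c).toNat]'(hmod i)
  let γ : ℤ → FreeGroup (Fin n) := fun i =>
    g * FreeGroup.mk p * FreeGroup.mk u ^ (i / c) * FreeGroup.mk (u.take (i % c).toNat)
  have hstep : ∀ i, γ (i + 1) = γ i * FreeGroup.mk [l i] := by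
    intro i
    have h0 := Int.emod_nonneg i hc'.ne'
    have h1 := Int.emod_lt_of_pos i hc'
    have e := Int.mul_ediv_add_emod i c
    have htake : u.take (i % c).toNat ++ [l i] = u.take ((i % c).toNat + 1) :=
      List.take_append_getElem (hmod i)
    have hγ : γ i * FreeGroup.mk [l i] = g * FreeGroup.mk p * FreeGroup.mk u ^ (i / c) *
        FreeGroup.mk (u.take ((i % c).toNat + 1)) := by
      simp only [γ]
      rw [mul_assoc _ _ (FreeGroup.mk [l i]), FreeGroup.mul_mk, htake]
    rw [hγ]
    -- At the last letter of a copy of `u` the quotient increases and the remainder returns to `0`.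
    by_cases hlast : i % c + 1 = c
    · have hd : (i + 1) / c = i / c + 1 ∧ (i + 1) % c = 0 := by
        rw [Int.ediv_emod_unique hc']
        refine ⟨by linarith [mul_add (c : ℤ) (i / c) 1], le_rfl, hc'⟩
      simp only [γ]
      rw [hd.1, hd.2, zpow_add_one, List.take_of_length_le (i := (i % (c : ℤ)).toNat + 1)
        (by omega), Int.toNat_zero, List.take_zero, ← FreeGroup.one_eq_mk, mul_one, ← mul_assoc]
    · have hd : (i + 1) / c = i / c ∧ (i + 1) % c = i % c + 1 := by
        rw [Int.ediv_emod_unique hc']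
        refine ⟨by linarith, by omega, by omega⟩
      simp only [γ]
      rw [hd.1, hd.2, show (i % (c : ℤ) + 1).toNat = (i % (c : ℤ)).toNat + 1 by omega]
  have hred : ∀ i, (l i).1 = (l (i + 1)).1 → (l i).2 = (l (i + 1)).2 := by
    intro i
    have h0 := Int.emod_nonneg i hc'.ne'
    have h1 := Int.emod_lt_of_pos i hc'
    -- Consecutive letters of `…uuu…`, including those at a seam, are consecutive in `u ++ u`.
    have huu : FreeGroup.IsReduced (u ++ u) := by
      simpa using (hcyc.flatten_replicate 2).isReduced
    have hk : (i % c).toNat + 1 < (u ++ u).length := by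
      rw [List.length_append]; have := hmod i; omega
    have h2 := List.isChain_iff_getElem.1 huu (i % c).toNat hk
    rw [List.getElem_append_left (hmod i)] at h2
    have h3 : (u ++ u)[(i % c).toNat + 1] = l (i + 1) := by
      have e := Int.mul_ediv_add_emod i c
      by_cases hlast : i % c + 1 = c
      · have hd : (i + 1) / c = i / c + 1 ∧ (i + 1) % c = 0 := by
          rw [Int.ediv_emod_unique hc']
          refine ⟨by linarith [mul_add (c : ℤ) (i / c) 1], le_rfl, hc'⟩
        rw [List.getElem_append_right (by omega)]
        simp only [l, hd.2]
        congr 1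
        omega
      · have hd : (i + 1) / c = i / c ∧ (i + 1) % c = i % c + 1 := by
          rw [Int.ediv_emod_unique hc']
          refine ⟨by linarith, by omega, by omega⟩
        rw [List.getElem_append_left (by omega)]
        simp only [l, hd.2]
        congr 1
        omega
    rw [h3] at h2
    exact h2
  have hper : ∀ i, l (i + c) = l i := by
    intro i
    simp only [l, Int.add_emod_right]
  have hgA : ∀ q : ℤ, g * A ^ q * FreeGroup.mk p = g * FreeGroup.mk p * FreeGroup.mk u ^ q := by
    intro q
    rw [hA, conj_zpow]; group
  have hnear : ∀ i, ∃ w : List (Fin n × Bool), w.length ≤ p.length + c ∧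
      γ i = g * A ^ (i / c) * FreeGroup.mk w := by
    intro i
    refine ⟨p ++ u.take (i % c).toNat, by simp; omega, ?_⟩
    rw [← FreeGroup.mul_mk, ← mul_assoc, hgA]
  refine ⟨γ, ⟨fun i => (adj_iff_exists_letter _ _).2 ⟨_, hstep i⟩, fun i h => ?_⟩, ?_, ?_, ?_⟩
  · have h1 : γ (i + 2) = γ i * FreeGroup.mk [l i, l (i + 1)] := by
      rw [show i + 2 = i + 1 + 1 by ring, hstep, hstep, mul_assoc, FreeGroup.mul_mk]; rfl
    rw [h1] at h
    have h2 : FreeGroup.mk [l i, l (i + 1)] = 1 := by simpa using h.symm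
    have h3 := congrArg FreeGroup.toWord h2
    have h4 : FreeGroup.IsReduced [l i, l (i + 1)] :=
      FreeGroup.isReduced_cons_cons.2 ⟨hred i, FreeGroup.IsReduced.singleton⟩
    rw [FreeGroup.toWord_mk, h4.reduce_eq] at h3
    simp at h3
  · refine HasPeriod.of_dvd (P := c) (fun i => ?_) (hP c hc hle)
    rw [hstep, hstep, hper]
    group
  · refine hξ.isEndOf (φ := fun i => (i / c).toNat) ?_ (p.length + c) ?_
    · refine tendsto_atTop.2 fun m => ?_
      filter_upwards [eventually_ge_atTop ((m : ℤ) * c)] with i hi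
      have := (Int.le_ediv_iff_mul_le hc').2 hi
      omega
    · filter_upwards [eventually_ge_atTop 0] with i hi
      obtain ⟨w, hw, e⟩ := hnear i
      refine ⟨w, hw, ?_⟩
      rw [e, ← zpow_natCast, Int.toNat_of_nonneg (Int.ediv_nonneg hi hc'.le)]
  -- Towards the negative end the exponent `-i / c` of `A` is at most `0`; its negative is the
  -- exponent of `A⁻¹`.
  · refine hη.isEndOf (φ := fun i => (-(-i / c)).toNat) ?_ (p.length + c) ?_
    · refine tendsto_atTop.2 fun m => ?_
      filter_upwards [eventually_ge_atTop ((m : ℤ) * c)] with i hi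
      have : -i / c < -m + 1 := by
        rw [Int.ediv_lt_iff_lt_mul hc']
        nlinarith
      omega
    · filter_upwards [eventually_ge_atTop 0] with i hi
      obtain ⟨w, hw, e⟩ := hnear (-i)
      refine ⟨w, hw, ?_⟩
      have h0 : -i / c ≤ 0 := by
        have : -i / c < 1 := by
          rw [Int.ediv_lt_iff_lt_mul hc']
          omega
        omega
      rw [e, ← zpow_natCast, Int.toNat_of_nonneg (by omega), inv_zpow', neg_neg]

/-- The reduced length of a word of the list is at most the total length of the list, so every
period that occurs divides the factorial of the latter. -/
theorem JoinedByLine.exists_isPeriodicLine {L : List (List (Fin n × Bool))} {ξ η : Boundary n}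
    (h : JoinedByLine L ξ η) : ∃ γ, IsPeriodicLine L.flatten.length.factorial γ ξ η := by
  obtain ⟨w, hw, g, hξ, hη⟩ := h
  refine isPeriodicLine_of_limits (fun k hk hle => Nat.dvd_factorial hk (hle.trans ?_)) hξ hη
  exact FreeGroup.norm_mk_le.trans (List.sublist_flatten_of_mem hw).length_le

/-! ## Finite subtrees and shadows -/

theorem exists_walk (u v : FreeGroup (Fin n)) : Nonempty ((cayleyTree n).Walk u v) := by
  have key : ∀ w : List (Fin n × Bool), Nonempty ((cayleyTree n).Walk u (u * FreeGroup.mk w)) := by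
    intro w
    induction w using List.reverseRecOn with
    | nil => rw [← FreeGroup.one_eq_mk, mul_one]; exact ⟨.nil⟩
    | append_singleton w t ih =>
      obtain ⟨p⟩ := ih
      rw [← FreeGroup.mul_mk, ← mul_assoc]
      exact ⟨p.concat (adj_mul_letter _ t)⟩
  have := key (u⁻¹ * v).toWord
  rwa [FreeGroup.mk_toWord, mul_inv_cancel_left] at this

namespace FiniteSubtree

variable (X : FiniteSubtree n)

/-- `u` and `v` lie in the same component of the complement of `X`. -/
def SameSide (u v : FreeGroup (Fin n)) : Prop :=
  ∃ p : (cayleyTree n).Walk u v, ∀ z ∈ p.support, z ∉ X.verts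

variable {X}

theorem SameSide.refl {u : FreeGroup (Fin n)} (h : u ∉ X.verts) : X.SameSide u u :=
  ⟨.nil, by simpa using h⟩

theorem SameSide.symm {u v : FreeGroup (Fin n)} : X.SameSide u v → X.SameSide v u := by
  rintro ⟨p, hp⟩
  exact ⟨p.reverse, by simpa using hp⟩

theorem SameSide.trans {u v w : FreeGroup (Fin n)} :
    X.SameSide u v → X.SameSide v w → X.SameSide u w := by
  rintro ⟨p, hp⟩ ⟨q, hq⟩
  refine ⟨p.append q, fun z hz => ?_⟩
  rcases (SimpleGraph.Walk.mem_support_append_iff _ _).1 hz with h | h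
  exacts [hp z h, hq z h]

theorem SameSide.right_notMem {u v : FreeGroup (Fin n)} : X.SameSide u v → v ∉ X.verts := by
  rintro ⟨p, hp⟩
  exact hp v p.end_mem_support

theorem SameSide.of_adj {u v : FreeGroup (Fin n)} (h : (cayleyTree n).Adj u v)
    (hu : u ∉ X.verts) (hv : v ∉ X.verts) : X.SameSide u v :=
  ⟨.cons h .nil, by simp [hu, hv]⟩

theorem SameSide.mono {Y : FiniteSubtree n} (hXY : X.verts ⊆ Y.verts) {u v : FreeGroup (Fin n)} :
    Y.SameSide u v → X.SameSide u v := by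
  rintro ⟨p, hp⟩
  exact ⟨p, fun z hz h => hp z hz (hXY h)⟩

theorem exists_walk_within {x y : FreeGroup (Fin n)} (hx : x ∈ X.verts) (hy : y ∈ X.verts) :
    ∃ p : (cayleyTree n).Walk x y, ∀ z ∈ p.support, z ∈ X.verts := by
  obtain ⟨p⟩ := X.connected.preconnected ⟨x, hx⟩ ⟨y, hy⟩
  have hp : ∀ z ∈ (p.map (SimpleGraph.Embedding.induce (X.verts : Set _)).toHom).support,
      z ∈ X.verts := fun z hz => by
    rw [SimpleGraph.Walk.support_map, List.mem_map] at hz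
    obtain ⟨z, -, rfl⟩ := hz
    exact z.2
  exact ⟨_, hp⟩

theorem not_halfTree {x a z : FreeGroup (Fin n)} (hx : x ∈ X.verts) (ha : a ∉ X.verts)
    (hadj : (cayleyTree n).Adj x a) (hz : z ∈ X.verts) : ¬ HalfTree x a z := fun h => by
  obtain ⟨p, hp⟩ := exists_walk_within hx hz
  exact ha (hp a (HalfTree.exists_dart_of_walk hadj p (HalfTree.not_base hadj) h).2)

theorem SameSide.halfTree {x a u : FreeGroup (Fin n)} (hx : x ∈ X.verts)
    (hadj : (cayleyTree n).Adj x a) (h : X.SameSide a u) : HalfTree x a u := by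
  by_contra hc
  obtain ⟨p, hp⟩ := h.symm
  exact hp x (HalfTree.exists_dart_of_walk hadj p hc (HalfTree.self _ _)).1 hx

/-- The edge from `X` to `b` would enter the half-tree beyond `a`, which is disjoint from `X`; only
the edge to `a` does so. Consequently the vertex chosen in `refineVertex` is the only possible one.
-/
theorem SameSide.eq_of_whVertex {a b : X.WhVertex} (h : X.SameSide a.1 b.1) : a = b := by
  obtain ⟨a, ha, x, hx, hxa⟩ := a
  obtain ⟨b, hb, y, hy, hyb⟩ := b
  have h1 := h.halfTree hx hxa
  have h2 := HalfTree.eq_of_enter hxa hyb (not_halfTree hx ha hxa hy) h1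
  exact Subtype.ext h2.2.symm

theorem Beyond.unique {a b : X.WhVertex} {u : FreeGroup (Fin n)} (ha : X.Beyond a u)
    (hb : X.Beyond b u) : a = b :=
  SameSide.eq_of_whVertex (SameSide.trans ha (SameSide.symm hb))

theorem exists_beyond {u : FreeGroup (Fin n)} (hu : u ∉ X.verts) : ∃ a, X.Beyond a u := by
  obtain ⟨x, hx⟩ := X.connected.nonempty
  obtain ⟨p⟩ := exists_walk u x
  induction p with
  | nil => exact absurd hx hu
  | cons h p ih =>
    rename_i u v w
    by_cases hv : v ∈ X.verts
    · exact ⟨⟨u, hu, v, hv, h.symm⟩, SameSide.refl hu⟩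
    · obtain ⟨a, ha⟩ := ih hv hx
      exact ⟨a, SameSide.trans ha (SameSide.of_adj h.symm hv hu)⟩

variable (X) in
/-- A radius (around the identity) that exceeds the finite subtree `X`. -/
def radius : ℕ := X.verts.sup (fun z => z.toWord.length) + 1

theorem notMem_of_radius_le {z : FreeGroup (Fin n)} (h : X.radius ≤ z.toWord.length) :
    z ∉ X.verts := fun hz => by
  have := Finset.le_sup (f := fun z : FreeGroup (Fin n) => z.toWord.length) hz
  rw [radius] at h
  omega

theorem sameSide_of_prefix {w : List (Fin n × Bool)} (hw : X.radius ≤ w.length)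
    {u : FreeGroup (Fin n)} (h : w <+: u.toWord) : X.SameSide (FreeGroup.mk w) u := by
  obtain ⟨r, hr⟩ := h
  induction r using List.reverseRecOn generalizing u with
  | nil =>
    have : u = FreeGroup.mk w := by
      rw [List.append_nil] at hr
      rw [hr, FreeGroup.mk_toWord]
    rw [← this]
    refine SameSide.refl (notMem_of_radius_le ?_)
    rw [← hr]; simpa using hw
  | append_singleton r t ih =>
    have hred : FreeGroup.IsReduced (w ++ r) :=
      FreeGroup.isReduced_toWord.infix (L₂ := u.toWord) ⟨[], [t], by simp [← hr]⟩
    have hv : (FreeGroup.mk (w ++ r)).toWord = w ++ r := by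
      rw [FreeGroup.toWord_mk, hred.reduce_eq]
    have hu : u = FreeGroup.mk (w ++ r) * FreeGroup.mk [t] := by
      rw [FreeGroup.mul_mk, List.append_assoc, hr, FreeGroup.mk_toWord]
    refine (ih (u := FreeGroup.mk (w ++ r)) hv.symm).trans ?_
    have hadj := adj_mul_letter (FreeGroup.mk (w ++ r)) t
    rw [← hu] at hadj
    refine SameSide.of_adj hadj (notMem_of_radius_le ?_) (notMem_of_radius_le ?_)
    · rw [hv, List.length_append]; omega
    · rw [← hr, List.length_append]; omega

theorem sameSide_ray {ξ : Boundary n} {k : ℕ} (hk : X.radius ≤ k) {u : FreeGroup (Fin n)}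
    (h : ξ.initial k <+: u.toWord) : X.SameSide (ξ.ray k) u :=
  sameSide_of_prefix (by simpa using hk) h

/-- From length `X.radius` on, a ray stays in one component of the complement of `X`, so a single
vertex of the ray decides membership. -/
theorem mem_shadow_iff {a : X.WhVertex} {ξ : Boundary n} :
    ξ ∈ X.shadow a ↔ X.Beyond a (ξ.ray X.radius) := by
  have key : ∀ k, X.radius ≤ k → X.SameSide (ξ.ray X.radius) (ξ.ray k) := fun k hk =>
    sameSide_ray le_rfl (by rw [ξ.toWord_ray]; exact ξ.initial_prefix hk)
  constructor
  · intro h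
    obtain ⟨k, hk, hk'⟩ := (h.and (eventually_ge_atTop X.radius)).exists
    exact SameSide.trans hk (key k hk').symm
  · intro h
    filter_upwards [eventually_ge_atTop X.radius] with k hk
    exact SameSide.trans h (key k hk)

theorem exists_mem_shadow (X : FiniteSubtree n) (ξ : Boundary n) : ∃ a, ξ ∈ X.shadow a := by
  obtain ⟨a, ha⟩ := exists_beyond (X := X) (u := ξ.ray X.radius)
    (notMem_of_radius_le (by rw [ξ.toWord_ray, ξ.length_initial]))
  exact ⟨a, mem_shadow_iff.2 ha⟩

theorem shadow_unique {a b : X.WhVertex} {ξ : Boundary n} (ha : ξ ∈ X.shadow a)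
    (hb : ξ ∈ X.shadow b) : a = b :=
  Beyond.unique (mem_shadow_iff.1 ha) (mem_shadow_iff.1 hb)

theorem mem_shadow_of_isEndOf {a : X.WhVertex} {ξ : Boundary n} {γ : ℤ → FreeGroup (Fin n)}
    (hξ : ξ.IsEndOf γ) (h : ∀ᶠ k in atTop, X.Beyond a (γ k)) : ξ ∈ X.shadow a := by
  obtain ⟨k, hk, hk'⟩ := ((hξ X.radius).and h).exists
  exact mem_shadow_iff.2 (SameSide.trans hk' (sameSide_ray le_rfl hk).symm)

theorem eventually_beyond {a : X.WhVertex} {ξ : Boundary n} {γ : ℤ → FreeGroup (Fin n)}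
    (hξ : ξ.IsEndOf γ) (h : ξ ∈ X.shadow a) : ∀ᶠ k in atTop, X.Beyond a (γ k) := by
  filter_upwards [hξ X.radius] with k hk
  exact SameSide.trans (mem_shadow_iff.1 h) (sameSide_ray le_rfl hk)

/-! ## Geodesics that pass through a finite subtree -/

/-- A walk inside `X` from `γ i` to `γ k` must use the edge of `γ` that starts at `γ j`. -/
theorem mem_of_between {γ : ℤ → FreeGroup (Fin n)} (hγ : IsGeodesic γ) {i j k : ℤ}
    (hi : γ i ∈ X.verts) (hk : γ k ∈ X.verts) (hij : i ≤ j) (hjk : j ≤ k) : γ j ∈ X.verts := by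
  rcases hjk.eq_or_lt with rfl | hlt
  · exact hk
  obtain ⟨p, hp⟩ := exists_walk_within hi hk
  exact hp _ (HalfTree.exists_dart_of_walk (hγ.adj j) p (hγ.not_halfTree_of_le hij)
    (hγ.halfTree_of_lt hlt)).1

theorem sameSide_of_exit {γ : ℤ → FreeGroup (Fin n)} (hγ : IsGeodesic γ) {i : ℤ}
    (hi : γ i ∈ X.verts) (hi' : γ (i + 1) ∉ X.verts) (k : ℕ) :
    X.SameSide (γ (i + 1)) (γ (i + 1 + k)) := by
  induction k with
  | zero => simpa using SameSide.refl hi'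
  | succ k ih =>
    refine ih.trans ?_
    have := hγ.adj (i + 1 + k)
    rw [show i + 1 + (k : ℤ) + 1 = i + 1 + (k + 1 : ℕ) by push_cast; ring] at this
    refine SameSide.of_adj this ih.right_notMem fun h => hi' ?_
    exact mem_of_between hγ hi h (by omega) (by push_cast; omega)

theorem mem_shadow_of_exit {γ : ℤ → FreeGroup (Fin n)} (hγ : IsGeodesic γ) {ξ : Boundary n}
    (hξ : ξ.IsEndOf γ) {i : ℤ} (hi : γ i ∈ X.verts) {a : X.WhVertex} (ha : γ (i + 1) = a.1) :
    ξ ∈ X.shadow a := by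
  refine mem_shadow_of_isEndOf hξ ?_
  filter_upwards [eventually_ge_atTop (i + 1)] with k hk
  have := sameSide_of_exit hγ hi (ha ▸ a.2.1) (k - (i + 1)).toNat
  rwa [show i + 1 + ((k - (i + 1)).toNat : ℤ) = k by omega, ha] at this

/-- A geodesic that meets `X` and ends in the shadow of `a` leaves `X` through `a`. -/
theorem exists_exit {γ : ℤ → FreeGroup (Fin n)} (hγ : IsGeodesic γ) {ξ : Boundary n}
    (hξ : ξ.IsEndOf γ) {i : ℤ} (hi : γ i ∈ X.verts) {a : X.WhVertex} (ha : ξ ∈ X.shadow a) :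
    ∃ j, i ≤ j ∧ γ j ∈ X.verts ∧ γ (j + 1) = a.1 := by
  obtain ⟨k, hk, hik⟩ := ((eventually_beyond hξ ha).and (eventually_ge_atTop i)).exists
  have : ∃ m : ℕ, γ (i + m) ∉ X.verts :=
    ⟨(k - i).toNat, by
      rw [show i + ((k - i).toNat : ℤ) = k by omega]; exact SameSide.right_notMem hk⟩
  classical
  obtain ⟨m, hm⟩ : ∃ m, Nat.find this = m + 1 := by
    refine Nat.exists_eq_succ_of_ne_zero fun h0 => ?_
    have := Nat.find_spec this
    rw [h0] at this
    exact this (by simpa using hi)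
  have h1 : γ (i + m) ∈ X.verts := not_not.1 (Nat.find_min this (by omega))
  have h2 : γ (i + m + 1) ∉ X.verts := by
    have := Nat.find_spec this
    rw [hm] at this
    rwa [show i + ((m + 1 : ℕ) : ℤ) = i + m + 1 by push_cast; ring] at this
  let a' : X.WhVertex := ⟨γ (i + m + 1), h2, _, h1, hγ.adj _⟩
  have h3 : a' = a := shadow_unique (mem_shadow_of_exit hγ hξ h1 rfl) ha
  exact ⟨i + m, by omega, h1, congrArg Subtype.val h3⟩

/-- A line between distinct shadows of `X` meets `X`. -/
theorem exists_mem_of_shadow_ne {γ : ℤ → FreeGroup (Fin n)} (hγ : IsGeodesic γ) {ξ η : Boundary n}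
    (hξ : ξ.IsEndOf γ) (hη : η.IsEndOf fun i => γ (-i)) {a b : X.WhVertex} (ha : ξ ∈ X.shadow a)
    (hb : η ∈ X.shadow b) (hab : a ≠ b) : ∃ i, γ i ∈ X.verts := by
  by_contra! hc
  obtain ⟨k, hk⟩ := (eventually_beyond hξ ha).exists
  obtain ⟨m, hm, hkm⟩ := ((eventually_beyond hη hb).and (eventually_ge_atTop (-k))).exists
  -- A line that misses `X` stays in one component of the complement, so its two ends would share a
  -- shadow.
  have key : ∀ l : ℕ, X.SameSide (γ (-m)) (γ (-m + l)) := by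
    intro l
    induction l with
    | zero => simpa using SameSide.refl (hc _)
    | succ l ih =>
      refine ih.trans ?_
      have := hγ.adj (-m + l)
      rw [show -m + (l : ℤ) + 1 = -m + (l + 1 : ℕ) by push_cast; ring] at this
      exact SameSide.of_adj this (hc _) (hc _)
  have := key (k + m).toNat
  rw [show -m + ((k + m).toNat : ℤ) = k by omega] at this
  exact hab (Beyond.unique hk (SameSide.trans hm this))

/-- A line between distinct shadows of `X` crosses `X`. -/
theorem exists_crossing {γ : ℤ → FreeGroup (Fin n)} (hγ : IsGeodesic γ) {ξ η : Boundary n}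
    (hξ : ξ.IsEndOf γ) (hη : η.IsEndOf fun i => γ (-i)) {a b : X.WhVertex} (ha : ξ ∈ X.shadow a)
    (hb : η ∈ X.shadow b) (hab : a ≠ b) :
    ∃ i j, i ≤ j ∧ γ i ∈ X.verts ∧ γ j ∈ X.verts ∧ γ (i - 1) = b.1 ∧ γ (j + 1) = a.1 := by
  obtain ⟨k, hk⟩ := exists_mem_of_shadow_ne hγ hξ hη ha hb hab
  obtain ⟨j, hkj, hj, hj'⟩ := exists_exit hγ hξ hk ha
  obtain ⟨i, hki, hi, hi'⟩ := exists_exit hγ.reverse hη (i := -k) (by simpa using hk) hb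
  exact ⟨-i, j, by omega, hi, hj, by rw [← hi']; congr 1; ring, hj'⟩

/-- The subtree spanned by a finite path. -/
def ofPath (f : ℕ → FreeGroup (Fin n)) (k : ℕ) (h : ∀ i < k, (cayleyTree n).Adj (f i) (f (i + 1))) :
    FiniteSubtree n where
  verts := (Finset.range (k + 1)).image f
  connected := by
    have hmem : ∀ i ≤ k, f i ∈ ((Finset.range (k + 1)).image f : Set (FreeGroup (Fin n))) :=
      fun i hi => Finset.mem_coe.2 (Finset.mem_image_of_mem f (Finset.mem_range.2 (by omega)))
    rw [SimpleGraph.connected_iff_exists_forall_reachable]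
    refine ⟨⟨f 0, hmem 0 (Nat.zero_le k)⟩, ?_⟩
    have key : ∀ i (hi : i ≤ k), ((cayleyTree n).induce
        ((Finset.range (k + 1)).image f : Set (FreeGroup (Fin n)))).Reachable
        ⟨f 0, hmem 0 (Nat.zero_le k)⟩ ⟨f i, hmem i hi⟩ := by
      intro i
      induction i with
      | zero => intro _; exact SimpleGraph.Reachable.refl _
      | succ i ih =>
        intro hi
        refine (ih (by omega)).trans (SimpleGraph.Adj.reachable ?_)
        exact h i (by omega)
    rintro ⟨z, hz⟩
    obtain ⟨i, hi, rfl⟩ := Finset.mem_image.1 (Finset.mem_coe.1 hz)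
    exact key i (by simpa [Nat.lt_succ_iff] using hi)

theorem mem_ofPath {f : ℕ → FreeGroup (Fin n)} {k : ℕ}
    {h : ∀ i < k, (cayleyTree n).Adj (f i) (f (i + 1))} {z : FreeGroup (Fin n)} :
    z ∈ (ofPath f k h).verts ↔ ∃ i ≤ k, f i = z := by
  simp [ofPath]

theorem card_ofPath_le {f : ℕ → FreeGroup (Fin n)} {k : ℕ}
    {h : ∀ i < k, (cayleyTree n).Adj (f i) (f (i + 1))} : (ofPath f k h).verts.card ≤ k + 1 := by
  simpa [ofPath] using Finset.card_image_le (s := Finset.range (k + 1)) (f := f)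

end FiniteSubtree

/-! ## The topology of the boundary -/

namespace Boundary

instance : T2Space (Boundary n) :=
  inferInstanceAs (T2Space {ξ : ℕ → Fin n × Bool // ∀ k, ξ (k + 1) ≠ ((ξ k).1, !(ξ k).2)})

theorem initial_eq_iff {ξ η : Boundary n} {m : ℕ} :
    ξ.initial m = η.initial m ↔ ∀ k < m, ξ.1 k = η.1 k := by
  simp [initial, List.map_inj_left]

theorem isOpen_cylinder (ξ : Boundary n) (m : ℕ) :
    IsOpen {η : Boundary n | ξ.initial m = η.initial m} := by
  have : {η : Boundary n | ξ.initial m = η.initial m} =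
      ⋂ k ∈ Finset.range m, {η : Boundary n | η.1 k = ξ.1 k} := by
    ext η
    simp [initial_eq_iff, eq_comm]
  rw [this]
  refine isOpen_biInter_finset fun k _ => ?_
  have hc : Continuous fun η : Boundary n => η.1 k :=
    (continuous_apply k).comp continuous_subtype_val
  exact (isOpen_discrete {ξ.1 k}).preimage hc

theorem exists_cylinder_subset {O : Set (Boundary n)} (hO : IsOpen O) {ξ : Boundary n}
    (hξ : ξ ∈ O) : ∃ m, ∀ η : Boundary n, ξ.initial m = η.initial m → η ∈ O := by
  obtain ⟨V, hV, rfl⟩ := isOpen_induced_iff.1 hO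
  obtain ⟨I, u, hu, hIu⟩ := isOpen_pi_iff.1 hV _ hξ
  refine ⟨I.sup id + 1, fun η h => hIu fun k hk => ?_⟩
  rw [initial_eq_iff] at h
  have := Finset.le_sup (f := id) hk
  rw [← h k (Nat.lt_succ_of_le this)]
  exact (hu k hk).2

end Boundary

theorem FiniteSubtree.isOpen_shadow (X : FiniteSubtree n) (a : X.WhVertex) :
    IsOpen (X.shadow a) := by
  rw [isOpen_iff_forall_mem_open]
  intro ξ hξ
  refine ⟨_, fun η hη => ?_, ξ.isOpen_cylinder X.radius, rfl⟩
  have hη : ξ.initial X.radius = η.initial X.radius := hη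
  rw [mem_shadow_iff] at hξ ⊢
  rwa [Boundary.ray, ← hη]

/-! ## The fibres of the projection to the decomposition space -/

section Fibres

variable (L : List (List (Fin n × Bool)))

/-- A common period of all lines of the line pattern. -/
def linePeriod : ℕ := L.flatten.length.factorial

theorem linePeriod_pos : 0 < linePeriod L := Nat.factorial_pos _

/-- `ξ` and `η` are the two ends of a line of the line pattern, in either order. -/
def Paired (ξ η : Boundary n) : Prop := JoinedByLine L ξ η ∨ JoinedByLine L η ξ

variable {L}

namespace Paired

variable {ξ η η' : Boundary n}

theorem symm (h : Paired L ξ η) : Paired L η ξ := Or.symm h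

theorem exists_isPeriodicLine (h : Paired L ξ η) :
    ∃ γ, IsPeriodicLine (linePeriod L) γ ξ η := by
  rcases h with h | h
  · exact h.exists_isPeriodicLine
  · obtain ⟨γ, hγ⟩ := h.exists_isPeriodicLine
    exact ⟨_, hγ.reverse⟩

theorem right_unique (h : Paired L ξ η) (h' : Paired L ξ η') : η = η' := by
  obtain ⟨γ, hγ⟩ := h.exists_isPeriodicLine
  obtain ⟨γ', hγ'⟩ := h'.exists_isPeriodicLine
  exact hγ.right_unique (linePeriod_pos L) hγ'

theorem left_unique (h : Paired L η ξ) (h' : Paired L η' ξ) : η = η' :=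
  h.symm.right_unique h'.symm

end Paired

/-- A boundary point has at most one partner, so "equal or paired" is already transitive and is the
generated equivalence relation. -/
theorem proj_eq_iff {ξ η : Boundary n} : proj L ξ = proj L η ↔ ξ = η ∨ Paired L ξ η := by
  constructor
  · intro h
    have h' := Quot.eqvGen_exact h
    clear h
    induction h' with
    | rel _ _ h => exact Or.inr (Or.inl h)
    | refl => exact Or.inl rfl
    | symm x y hxy ih => exact ih.imp Eq.symm Paired.symm
    | trans x y z hxy hyz ih ih' =>
      rcases ih with rfl | h1
      · exact ih'
      · rcases ih' with rfl | h2
        · exact Or.inr h1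
        · exact Or.inl (h1.left_unique h2.symm)
  · rintro (rfl | h | h)
    · rfl
    · exact Quot.sound h
    · exact (Quot.sound h).symm

theorem finite_ball (v : FreeGroup (Fin n)) (r : ℕ) :
    {u : FreeGroup (Fin n) | (v⁻¹ * u).toWord.length ≤ r}.Finite := by
  refine ((List.finite_length_le (Fin n × Bool) r).image fun w => v * FreeGroup.mk w).subset ?_
  intro u hu
  exact ⟨_, hu, by simp only [FreeGroup.mk_toWord, mul_inv_cancel_left]⟩

theorem IsGeodesic.length_le {γ : ℤ → FreeGroup (Fin n)} (hγ : IsGeodesic γ) (i : ℤ) (k : ℕ) :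
    ((γ i)⁻¹ * γ (i + k)).toWord.length ≤ k := by
  induction k with
  | zero => simp
  | succ k ih =>
    obtain ⟨t, ht⟩ := (adj_iff_exists_letter _ _).1 (hγ.adj (i + k))
    rw [show i + ((k + 1 : ℕ) : ℤ) = i + k + 1 by push_cast; ring, ht, ← mul_assoc]
    refine (FreeGroup.norm_mul_le _ _).trans (add_le_add ih ?_)
    exact FreeGroup.norm_mk_le

/-- The ends of the lines of the line pattern that run between distinct shadows of `X`. -/
def crossingEnds (L : List (List (Fin n × Bool))) (X : FiniteSubtree n) : Set (Boundary n) :=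
  {ξ | ∃ η, Paired L ξ η ∧ ∃ a b, a ≠ b ∧ ξ ∈ X.shadow a ∧ η ∈ X.shadow b}

/-- A crossing line has a vertex `v` in `X`. Parametrized from `v`, its end is determined by `v` and
the vertex `linePeriod L` steps later, which lies in a finite ball. -/
theorem finite_crossingEnds (L : List (List (Fin n × Bool))) (X : FiniteSubtree n) :
    (crossingEnds L X).Finite := by
  let T : FreeGroup (Fin n) → FreeGroup (Fin n) → Set (Boundary n) := fun v u =>
    {ξ | ∃ η γ, IsPeriodicLine (linePeriod L) γ ξ η ∧ γ 0 = v ∧ γ (linePeriod L) = u}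
  have hT : ∀ v u, (T v u).Finite := fun v u => by
    refine Set.Subsingleton.finite ?_
    rintro ξ ⟨η, γ, h, rfl, rfl⟩ ξ' ⟨η', γ', h', h0, h1⟩
    exact (h.ends_eq (linePeriod_pos L) h' (i := 0) h0.symm (by rw [zero_add]; exact h1.symm)
      (Int.natCast_nonneg _)).1
  refine (Set.Finite.biUnion X.verts.finite_toSet fun v _ =>
    Set.Finite.biUnion (finite_ball v (linePeriod L)) fun u _ => hT v u).subset ?_
  rintro ξ ⟨η, h, a, b, hab, ha, hb⟩
  obtain ⟨γ, hγ⟩ := h.exists_isPeriodicLine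
  obtain ⟨i, hi⟩ := FiniteSubtree.exists_mem_of_shadow_ne hγ.geodesic hγ.pos_end hγ.neg_end
    ha hb hab
  refine Set.mem_biUnion (x := γ i) hi (Set.mem_biUnion (x := γ (i + linePeriod L)) ?_ ?_)
  · exact hγ.geodesic.length_le i _
  · exact ⟨η, _, hγ.shift i, by rw [zero_add], by rw [add_comm]⟩

/-- The union of the fibres contained in an open set is open. -/
theorem isOpen_saturated_core {O : Set (Boundary n)} (hO : IsOpen O) :
    IsOpen {ξ | ∀ η, proj L η = proj L ξ → η ∈ O} := by
  rw [isOpen_iff_forall_mem_open]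
  intro ξ hξ
  obtain ⟨m, hm⟩ := Boundary.exists_cylinder_subset hO (hξ ξ rfl)
  -- With the single vertex `ξ.ray m` as subtree, the shadow of the next vertex of the ray lies in a
  -- cylinder inside `O`.
  let X := FiniteSubtree.ofPath (fun _ => ξ.ray m) 0 (by simp)
  have hX1 : X.verts = {ξ.ray m} := by simp [X, FiniteSubtree.ofPath]
  have hX : ξ.ray m ∈ X.verts := by simp [hX1]
  have hX' : ξ.ray (m + 1) ∉ X.verts := fun h =>
    (ξ.ray_adj m).ne (Finset.mem_singleton.1 (hX1 ▸ h)).symm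
  let a : X.WhVertex := ⟨ξ.ray (m + 1), hX', ξ.ray m, hX, ξ.ray_adj m⟩
  have ha : ξ ∈ X.shadow a := by
    refine FiniteSubtree.mem_shadow_iff.2 ?_
    have hr : X.radius = m + 1 := by
      simp [FiniteSubtree.radius, hX1, ξ.toWord_ray]
    rw [hr]
    exact FiniteSubtree.SameSide.refl hX'
  have hsub : ∀ η ∈ X.shadow a, η ∈ O := by
    intro η hη
    obtain ⟨k, hk, hmk⟩ := (hη.and (eventually_ge_atTop (m + 1))).exists
    have h1 := FiniteSubtree.SameSide.halfTree hX (ξ.ray_adj m) hk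
    rw [Boundary.halfTree_ray_iff, η.toWord_ray] at h1
    exact hm η (Boundary.initial_eq_of_prefix ((ξ.initial_prefix (by omega)).trans h1)
      (η.initial_prefix (by omega)))
  -- Only finitely many points of the shadow have a partner outside it. All of them except `ξ` are
  -- removed; the fibre of `ξ` lies in `O` by assumption.
  refine ⟨X.shadow a ∩ (crossingEnds L X \ {ξ})ᶜ, ?_, ?_, ha, by simp⟩
  · rintro ζ ⟨hζ, hζ'⟩ η hη
    obtain ⟨b, hb⟩ := X.exists_mem_shadow η
    by_cases hab : a = b
    · exact hsub η (hab ▸ hb)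
    · rcases proj_eq_iff.1 hη with rfl | h
      · exact absurd (FiniteSubtree.shadow_unique hζ hb) hab
      · have : ζ = ξ := by
          by_contra hc
          exact hζ' ⟨⟨η, h.symm, a, b, hab, hζ, hb⟩, hc⟩
        exact hξ η (this ▸ hη)
  · exact (X.isOpen_shadow a).inter ((finite_crossingEnds L X).sdiff.isClosed.isOpen_compl)

theorem isOpen_fibres_subset {O : Set (Boundary n)} (hO : IsOpen O) :
    IsOpen {d : DecompositionSpace L | ∀ η, proj L η = d → η ∈ O} :=
  isOpen_coinduced.2 (isOpen_saturated_core hO)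

theorem continuous_proj : Continuous (proj L) := continuous_quot_mk

end Fibres

/-! ## Existence of fine associated covers -/

theorem FiniteSubtree.whiteheadGraph_adj {L : List (List (Fin n × Bool))} {X : FiniteSubtree n}
    {a b : X.WhVertex} : (X.whiteheadGraph L).Adj a b ↔
      a ≠ b ∧ ∃ ξ ∈ X.shadow a, ∃ η ∈ X.shadow b, Paired L ξ η := by
  rw [FiniteSubtree.whiteheadGraph, SimpleGraph.fromRel_adj]
  refine and_congr_right fun _ => ⟨?_, ?_⟩
  · rintro (⟨ξ, hξ, η, hη, h⟩ | ⟨ξ, hξ, η, hη, h⟩)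
    · exact ⟨ξ, hξ, η, hη, Or.inl h⟩
    · exact ⟨η, hη, ξ, hξ, Or.inr h⟩
  · rintro ⟨ξ, hξ, η, hη, h | h⟩
    · exact Or.inl ⟨ξ, hξ, η, hη, h⟩
    · exact Or.inr ⟨η, hη, ξ, hξ, h⟩

/-- There are associated covers finer than any given family of open neighbourhoods of the
shadows. -/
theorem exists_associatedCover {L : List (List (Fin n × Bool))} (X : FiniteSubtree n)
    (W : X.WhVertex → Set (DecompositionSpace L)) (hW : ∀ a, IsOpen (W a))
    (hsub : ∀ a, proj L '' X.shadow a ⊆ W a) :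
    ∃ c : AssociatedCover L X, ∀ a, c.U a ⊆ W a := by
  obtain ⟨V, hV, hdisj⟩ := (finite_crossingEnds L X).t2_separation
  -- `O a` enlarges the shadow of `a` by small neighbourhoods of the far ends of the lines leaving
  -- it. The members of the cover consist of the points whose whole fibre lies in `O a`.
  let B : X.WhVertex → X.WhVertex → Boundary n → Set (Boundary n) := fun a b ξ =>
    V ξ ∩ X.shadow b ∩ proj L ⁻¹' W a
  let N : X.WhVertex → Set (Boundary n) := fun a =>
    {x | ∃ b ξ η, b ≠ a ∧ ξ ∈ X.shadow b ∧ η ∈ X.shadow a ∧ Paired L ξ η ∧ x ∈ B a b ξ}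
  let O : X.WhVertex → Set (Boundary n) := fun a => X.shadow a ∪ N a
  have hN : ∀ a, IsOpen (N a) := by
    intro a
    rw [isOpen_iff_forall_mem_open]
    rintro x ⟨b, ξ, η, hba, hξ, hη, h, hx⟩
    exact ⟨B a b ξ, fun y hy => ⟨b, ξ, η, hba, hξ, hη, h, hy⟩,
      ((hV ξ).2.inter (X.isOpen_shadow b)).inter ((hW a).preimage continuous_proj), hx⟩
  have hO : ∀ a, IsOpen (O a) := fun a => (X.isOpen_shadow a).union (hN a)
  have hOW : ∀ a, ∀ x ∈ O a, proj L x ∈ W a := by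
    rintro a x (hx | ⟨b, ξ, η, -, -, -, -, hx⟩)
    · exact hsub a ⟨x, hx, rfl⟩
    · exact hx.2
  -- A point near a crossing end determines that end by disjointness, hence its partner and the
  -- shadow of the partner.
  have hNN : ∀ a b x, x ∈ N a → x ∈ N b → a = b := by
    rintro a b x ⟨c, ξ, η, hca, hξ, hη, h, hx⟩ ⟨c', ξ', η', hcb, hξ', hη', h', hx'⟩
    have e : ξ = ξ' := by
      by_contra hne
      exact Set.disjoint_left.1 (hdisj ⟨η, h, c, a, hca, hξ, hη⟩ ⟨η', h', c', b, hcb, hξ', hη'⟩ hne)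
        hx.1.1 hx'.1.1
    subst e
    have e' := h.right_unique h'
    subst e'
    exact FiniteSubtree.shadow_unique hη hη'
  have hSN : ∀ a b x, x ∈ X.shadow a → x ∈ N b → (X.whiteheadGraph L).Adj a b := by
    rintro a b x hx ⟨c, ξ, η, hcb, hξ, hη, h, hx'⟩
    obtain rfl := FiniteSubtree.shadow_unique hx hx'.1.2
    exact FiniteSubtree.whiteheadGraph_adj.2 ⟨hcb, ξ, hξ, η, hη, h⟩
  have hU : ∀ a, proj L '' X.shadow a ⊆ {d | ∀ η, proj L η = d → η ∈ O a} := by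
    rintro a _ ⟨x, hx, rfl⟩ η hη
    obtain ⟨b, hb⟩ := X.exists_mem_shadow η
    by_cases hba : b = a
    · exact Or.inl (hba ▸ hb)
    · rcases proj_eq_iff.1 hη with rfl | h
      · exact Or.inl hx
      · exact Or.inr ⟨b, η, x, hba, hb, hx, h,
          ⟨⟨(hV η).1, hb⟩, by rw [Set.mem_preimage, hη]; exact hsub a ⟨x, hx, rfl⟩⟩⟩
  refine ⟨⟨fun a => {d | ∀ η, proj L η = d → η ∈ O a}, fun a => isOpen_fibres_subset (hO a),
    ?_, hU, ?_, ?_⟩, ?_⟩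
  · refine Set.eq_univ_of_forall fun d => ?_
    obtain ⟨x, rfl⟩ := Quot.exists_rep d
    obtain ⟨a, ha⟩ := X.exists_mem_shadow x
    exact Set.mem_iUnion.2 ⟨a, hU a ⟨x, ha, rfl⟩⟩
  · intro a b hab
    constructor
    · rintro ⟨d, hda, hdb⟩
      obtain ⟨x, rfl⟩ := Quot.exists_rep d
      rcases hda x rfl with ha | ha <;> rcases hdb x rfl with hb | hb
      · exact absurd (FiniteSubtree.shadow_unique ha hb) hab
      · exact hSN a b x ha hb
      · exact (hSN b a x hb ha).symm
      · exact absurd (hNN a b x ha hb) hab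
    · intro h
      obtain ⟨-, ξ, hξ, η, hη, h⟩ := FiniteSubtree.whiteheadGraph_adj.1 h
      refine ⟨proj L ξ, hU a ⟨ξ, hξ, rfl⟩, hU b ⟨η, hη, ?_⟩⟩
      exact (proj_eq_iff.2 (Or.inr h)).symm
  -- Of three memberships, two come from shadows or two from the added neighbourhoods; either makes
  -- two indices equal.
  · intro a b c hab hbc hac
    refine Set.eq_empty_of_forall_notMem ?_
    rintro d ⟨⟨hda, hdb⟩, hdc⟩
    obtain ⟨x, rfl⟩ := Quot.exists_rep d
    rcases hda x rfl with ha | ha <;> rcases hdb x rfl with hb | hb <;>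
      rcases hdc x rfl with hc | hc
    · exact hab (FiniteSubtree.shadow_unique ha hb)
    · exact hab (FiniteSubtree.shadow_unique ha hb)
    · exact hac (FiniteSubtree.shadow_unique ha hc)
    · exact hbc (hNN b c x hb hc)
    · exact hbc (FiniteSubtree.shadow_unique hb hc)
    · exact hac (hNN a c x ha hc)
    · exact hab (hNN a b x ha hb)
    · exact hab (hNN a b x ha hb)
  · intro a d hd
    obtain ⟨x, rfl⟩ := Quot.exists_rep d
    exact hOW a x (hd x rfl)

/-! ## Supports of cochains -/

instance (X : FiniteSubtree n) : Finite X.WhVertex := by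
  refine ((Set.Finite.biUnion X.verts.finite_toSet fun x _ => finite_ball x 1).subset ?_).to_subtype
  rintro a ⟨-, x, hx, hxa⟩
  obtain ⟨t, rfl⟩ := (adj_iff_exists_letter _ _).1 hxa
  refine Set.mem_biUnion (x := x) hx ?_
  simp only [Set.mem_ofPred_eq, inv_mul_cancel_left]
  exact FreeGroup.norm_mk_le

theorem FiniteSubtree.shadow_subset_of_beyond {X Y : FiniteSubtree n} (hXY : X.verts ⊆ Y.verts)
    {a : X.WhVertex} {b : Y.WhVertex} (h : X.Beyond a b.1) : Y.shadow b ⊆ X.shadow a := by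
  intro ξ hξ
  filter_upwards [hξ] with k hk
  exact SameSide.trans h (SameSide.mono hXY hk)

namespace TreeCover

variable {L : List (List (Fin n × Bool))} {s : ℤˣ}

theorem beyond_refineVertex {c d : TreeCover L} (h : c ≤ d) (b : d.tree.WhVertex) :
    c.tree.Beyond (refineVertex h b) b.1 := (h.2 b).choose_spec.1

theorem cochain_symm {c : TreeCover L} (f : c.cochains s) (a b : c.tree.WhVertex) :
    f.1 b a = s * f.1 a b := f.2.1 a b

theorem adj_of_cochain_ne_zero {c : TreeCover L} (f : c.cochains s) {a b : c.tree.WhVertex}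
    (h : f.1 a b ≠ 0) : (c.tree.whiteheadGraph L).Adj a b := by
  have := not_not.1 (mt (f.2.2 a b) h)
  exact (c.cover.inter_nonempty_iff a b this.1).1 this.2

theorem cochain_self {c : TreeCover L} (f : c.cochains s) (a : c.tree.WhVertex) :
    f.1 a a = 0 := f.2.2 a a fun h => h.1 rfl

open Classical in
/-- The cochain with values `z` and `s * z` on an edge of the Whitehead graph, and zero
elsewhere. -/
def edgeCochain (s : ℤˣ) (c : TreeCover L) {a b : c.tree.WhVertex}
    (h : (c.tree.whiteheadGraph L).Adj a b) (z : ℤ) : c.cochains s :=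
  ⟨fun v w => if v = a ∧ w = b then z else if v = b ∧ w = a then s * z else 0, by
    have hss : (s : ℤ) * s = 1 := by
      rw [← Units.val_mul, Int.units_mul_self, Units.val_one]
    refine ⟨fun v w => ?_, fun v w hvw => ?_⟩ <;> dsimp only
    · by_cases h1 : v = a ∧ w = b
      · obtain ⟨rfl, rfl⟩ := h1
        simp [h.ne, h.ne']
      · by_cases h2 : v = b ∧ w = a
        · obtain ⟨rfl, rfl⟩ := h2
          simp [h.ne, h.ne', ← mul_assoc, hss]
        · rw [if_neg h1, if_neg h2, if_neg (fun h' => h2 h'.symm), if_neg (fun h' => h1 h'.symm),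
            mul_zero]
    · have key := (c.cover.inter_nonempty_iff a b h.ne).2 h
      rw [if_neg, if_neg]
      · rintro ⟨rfl, rfl⟩
        exact hvw ⟨h.ne', by rwa [Set.inter_comm]⟩
      · rintro ⟨rfl, rfl⟩
        exact hvw ⟨h.ne, key⟩⟩

theorem edgeCochain_left {c : TreeCover L} {a b : c.tree.WhVertex}
    (h : (c.tree.whiteheadGraph L).Adj a b) (z : ℤ) : (edgeCochain s c h z).1 a b = z :=
  if_pos ⟨rfl, rfl⟩

theorem edgeCochain_right {c : TreeCover L} {a b : c.tree.WhVertex}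
    (h : (c.tree.whiteheadGraph L).Adj a b) (z : ℤ) : (edgeCochain s c h z).1 b a = s * z := by
  rw [cochain_symm, edgeCochain_left]

theorem edgeCochain_eq_zero {c : TreeCover L} {a b v w : c.tree.WhVertex}
    (h : (c.tree.whiteheadGraph L).Adj a b) (z : ℤ) (h1 : ¬ (v = a ∧ w = b))
    (h2 : ¬ (v = b ∧ w = a)) : (edgeCochain s c h z).1 v w = 0 :=
  (if_neg h1).trans (if_neg h2)

end TreeCover

open Classical in
/-- The class in the direct limit of a cochain of a cover. -/
noncomputable abbrev cochainClass {L : List (List (Fin n × Bool))} {s : ℤˣ} (c : TreeCover L) :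
    c.cochains s →+ CochainLimit L s :=
  AddCommGroup.DirectLimit.of (fun c : TreeCover L => c.cochains s)
    (fun _ _ h => TreeCover.refineCochain s h) c

theorem cochainClass_refine {L : List (List (Fin n × Bool))} {s : ℤˣ} {c d : TreeCover L}
    (h : c ≤ d) (f : c.cochains s) :
    cochainClass d (TreeCover.refineCochain s h f) = cochainClass c f := by
  classical
  exact AddCommGroup.DirectLimit.of_f (G := fun c : TreeCover L => c.cochains s)
    (f := fun _ _ h => TreeCover.refineCochain s h) h f

/-- Restricting to a shorter piece of a line: if a line of the pattern runs from `b` to `a`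
through `X`, there is a subtree `Y` of `X` with at most `linePeriod L + 1` vertices and vertices
`a'`, `b'` such that the lines between `a'` and `b'` at `Y` are those between `a` and `b` at `X`. -/
theorem FiniteSubtree.exists_small_subtree {L : List (List (Fin n × Bool))} {X : FiniteSubtree n}
    {a b : X.WhVertex} (hab : (X.whiteheadGraph L).Adj a b) :
    ∃ (Y : FiniteSubtree n) (a' b' : Y.WhVertex), Y.verts ⊆ X.verts ∧
      Y.verts.card ≤ linePeriod L + 1 ∧ (Y.whiteheadGraph L).Adj a' b' ∧
      Y.Beyond a' a.1 ∧ Y.Beyond b' b.1 ∧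
      ∀ v w : X.WhVertex, (X.whiteheadGraph L).Adj v w → Y.Beyond a' v.1 → Y.Beyond b' w.1 →
        v = a ∧ w = b := by
  obtain ⟨hne, ξ, hξ, η, hη, h⟩ := whiteheadGraph_adj.1 hab
  obtain ⟨γ, hγ⟩ := h.exists_isPeriodicLine
  have hg := hγ.geodesic
  obtain ⟨i, j, hij, hi, hj, hib, hja⟩ := exists_crossing hg hγ.pos_end hγ.neg_end hξ hη hne
  -- The segment starts where the line enters `X` and stops after one period or at the exit,
  -- whichever comes first.
  obtain ⟨k, hk, hkP, hk'⟩ : ∃ k : ℕ, i + k ≤ j ∧ k ≤ linePeriod L ∧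
      (i + k = j ∨ k = linePeriod L) :=
    ⟨min (j - i).toNat (linePeriod L), by omega, by omega, by omega⟩
  let Y := ofPath (fun t => γ (i + t)) k fun t _ => by
    have := hg.adj (i + t)
    rwa [show i + (t : ℤ) + 1 = i + (t + 1 : ℕ) by push_cast; ring] at this
  have hY : ∀ z, z ∈ Y.verts ↔ ∃ t ≤ k, γ (i + t) = z := fun z => mem_ofPath
  have hYX : Y.verts ⊆ X.verts := fun z hz => by
    obtain ⟨t, ht, rfl⟩ := (hY z).1 hz
    exact mem_of_between hg hi hj (by omega) (by omega)
  have ha0 : γ (i + k + 1) ∉ Y.verts := fun hz => by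
    obtain ⟨t, ht, e⟩ := (hY _).1 hz
    have := hg.injective e
    omega
  have hb0 : γ (i - 1) ∉ Y.verts := fun hz => by
    obtain ⟨t, ht, e⟩ := (hY _).1 hz
    have := hg.injective e
    omega
  have hik : γ (i + k) ∈ Y.verts := (hY _).2 ⟨k, le_rfl, rfl⟩
  have hi0 : γ i ∈ Y.verts := (hY _).2 ⟨0, Nat.zero_le k, by simp⟩
  have hadjb : (cayleyTree n).Adj (γ i) (γ (i - 1)) := by
    have := (hg.adj (i - 1)).symm
    rwa [sub_add_cancel] at this
  let a' : Y.WhVertex := ⟨γ (i + k + 1), ha0, _, hik, hg.adj _⟩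
  let b' : Y.WhVertex := ⟨γ (i - 1), hb0, _, hi0, hadjb⟩
  have hab' : a' ≠ b' := fun e => by
    have := hg.injective (congrArg Subtype.val e)
    omega
  refine ⟨Y, a', b', hYX, card_ofPath_le.trans (by omega), ?_, ?_, ?_, ?_⟩
  · refine whiteheadGraph_adj.2 ⟨hab', ξ, mem_shadow_of_exit hg hγ.pos_end hik rfl, η, ?_, h⟩
    exact mem_shadow_of_exit hg.reverse hγ.neg_end (i := -i) (by simpa using hi0)
      (congrArg γ (by ring))
  · have := sameSide_of_exit hg hik ha0 (j - (i + k)).toNat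
    rwa [show i + k + 1 + ((j - (i + k)).toNat : ℤ) = j + 1 by omega, hja] at this
  · rw [← hib]
    exact SameSide.refl hb0
  · intro v w hvw hv hw
    obtain ⟨-, ξ', hξ', η', hη', h'⟩ := whiteheadGraph_adj.1 hvw
    obtain ⟨γ', hγ'⟩ := h'.exists_isPeriodicLine
    have hg' := hγ'.geodesic
    obtain ⟨i', j', hij', -, -, hib', hja'⟩ := exists_crossing hg' hγ'.pos_end hγ'.neg_end
      (shadow_subset_of_beyond hYX hv hξ') (shadow_subset_of_beyond hYX hw hη') hab'
    -- Any other such line also passes `b'` and then `a'`, so it shares the `k + 2` steps from `γ (i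
    -- - 1)` to `γ (i + k + 1)`.
    have key := hg.eq_of_common hg' (k + 2) (i := i - 1) (i' := i' - 1) (j' := j' + 1) hib'.symm
      (by rw [hja']; exact congrArg γ (by push_cast; ring)) (by omega)
    have key' : ∀ t : ℕ, t ≤ k + 1 → γ (i + t) = γ' (i' + t) := fun t ht => by
      have := key (t + 1) (by omega)
      rwa [show i - 1 + ((t + 1 : ℕ) : ℤ) = i + t by push_cast; ring,
        show i' - 1 + ((t + 1 : ℕ) : ℤ) = i' + t by push_cast; ring] at this
    constructor
    -- If the segment is the whole crossing, the second line also leaves `X` through `a`. Otherwise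
    -- a full period is shared and the ends agree.
    · rcases hk' with hk' | hk'
      · refine shadow_unique hξ' (mem_shadow_of_exit hg' hγ'.pos_end (i := i' + k) ?_ ?_)
        · rw [← key' k (by omega), hk']; exact hj
        · rw [← hja, ← hk']
          have := key' (k + 1) le_rfl
          push_cast at this
          rw [add_assoc, add_assoc, this]
      · have h0 := key' 0 (by omega)
        simp only [Nat.cast_zero, add_zero] at h0
        have e := (hγ.ends_eq (linePeriod_pos L) hγ' h0 (hk' ▸ key' k (by omega)) (by omega)).1
        exact shadow_unique hξ' (e ▸ hξ)
    -- No cases are needed at this end, since `b'` and `b` are the same vertex of the tree.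
    · have h0 := key' 0 (by omega)
      simp only [Nat.cast_zero, add_zero] at h0
      refine shadow_unique hη' (mem_shadow_of_exit hg'.reverse hγ'.neg_end (i := -i') ?_ ?_)
      · rw [neg_neg, ← h0]; exact hi
      · rw [← hib]
        exact (congrArg γ' (by ring)).trans hib'

/-- A cochain with values on a single edge of the Whitehead graph is supported on a small
subtree. -/
theorem exists_supportedOn_edgeCochain {L : List (List (Fin n × Bool))} {s : ℤˣ} (c : TreeCover L)
    {a b : c.tree.WhVertex} (hab : (c.tree.whiteheadGraph L).Adj a b) (z : ℤ) :
    ∃ Y : FiniteSubtree n, Y.verts.card < linePeriod L + 2 ∧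
      SupportedOn Y (cochainClass c (TreeCover.edgeCochain s c hab z)) := by
  obtain ⟨Y, a', b', hYX, hcard, hab', ha, hb, key⟩ :=
    FiniteSubtree.exists_small_subtree hab
  obtain ⟨e, -⟩ := exists_associatedCover (L := L) Y (fun _ => Set.univ) (fun _ => isOpen_univ)
    fun _ => Set.subset_univ _
  have hπ : ∀ v : c.tree.WhVertex, ∃ y : Y.WhVertex, Y.Beyond y v.1 := fun v =>
    FiniteSubtree.exists_beyond fun hv => v.2.1 (hYX hv)
  choose π hπ using hπ
  -- A cover on the large tree that refines both the given cover and the one on `Y`; the two classes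
  -- are compared there.
  obtain ⟨d, hd⟩ := exists_associatedCover c.tree (fun v => c.cover.U v ∩ e.U (π v))
    (fun v => (c.cover.isOpen v).inter (e.isOpen _)) fun v => Set.subset_inter
      (c.cover.shadow_subset v)
      ((Set.image_mono (FiniteSubtree.shadow_subset_of_beyond hYX (hπ v))).trans
        (e.shadow_subset _))
  let c' : TreeCover L := ⟨Y, e⟩
  let d' : TreeCover L := ⟨c.tree, d⟩
  have hcd : c ≤ d' := ⟨subset_rfl, fun v => ⟨v, FiniteSubtree.SameSide.refl v.2.1,
    (hd v).trans Set.inter_subset_left⟩⟩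
  have hcd' : c' ≤ d' := ⟨hYX, fun v => ⟨π v, hπ v, (hd v).trans Set.inter_subset_right⟩⟩
  refine ⟨Y, by omega, c', TreeCover.edgeCochain s c' hab' z, rfl, ?_⟩
  change cochainClass c' _ = _
  rw [← cochainClass_refine hcd, ← cochainClass_refine hcd']
  congr 1
  refine Subtype.ext (funext fun v => funext fun w => ?_)
  have e1 : ∀ v : d'.tree.WhVertex, TreeCover.refineVertex hcd v = v := fun v =>
    FiniteSubtree.SameSide.eq_of_whVertex (TreeCover.beyond_refineVertex hcd v)
  have e2 : ∀ v : d'.tree.WhVertex, TreeCover.refineVertex hcd' v = a' ↔ Y.Beyond a' v.1 :=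
    fun v => ⟨fun h => h ▸ TreeCover.beyond_refineVertex hcd' v,
      fun h => FiniteSubtree.Beyond.unique (TreeCover.beyond_refineVertex hcd' v) h⟩
  have e3 : ∀ v : d'.tree.WhVertex, TreeCover.refineVertex hcd' v = b' ↔ Y.Beyond b' v.1 :=
    fun v => ⟨fun h => h ▸ TreeCover.beyond_refineVertex hcd' v,
      fun h => FiniteSubtree.Beyond.unique (TreeCover.beyond_refineVertex hcd' v) h⟩
  simp only [TreeCover.refineCochain, AddMonoidHom.coe_mk, ZeroHom.coe_mk]
  symm
  split_ifs with hne
  · by_cases hvw : v = w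
    · subst hvw
      rw [TreeCover.cochain_self, TreeCover.cochain_self]
    have hadj : (c.tree.whiteheadGraph L).Adj v w := (d.inter_nonempty_iff v w hvw).1 hne
    rw [e1, e1]
    by_cases h1 : v = a ∧ w = b
    · obtain ⟨rfl, rfl⟩ := h1
      rw [(e2 v).2 ha, (e3 w).2 hb]
      exact (TreeCover.edgeCochain_left hab z).trans
        (TreeCover.edgeCochain_left (c := c') hab' z).symm
    · by_cases h2 : v = b ∧ w = a
      · obtain ⟨rfl, rfl⟩ := h2
        rw [(e2 w).2 ha, (e3 v).2 hb]
        exact (TreeCover.edgeCochain_right hab z).trans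
          (TreeCover.edgeCochain_right (c := c') hab' z).symm
      · refine (TreeCover.edgeCochain_eq_zero hab z h1 h2).trans
          (TreeCover.edgeCochain_eq_zero (c := c') hab' z ?_ ?_).symm
        · rintro ⟨h3, h4⟩
          exact h1 (key v w hadj ((e2 v).1 h3) ((e3 w).1 h4))
        · rintro ⟨h3, h4⟩
          exact h2 (key w v hadj.symm ((e2 w).1 h4) ((e3 v).1 h3)).symm
  · rfl

/-- Subtracting the edge cochain of one nonzero value kills that value and its mirror image and
changes nothing else, so induction on the number of nonzero values applies. -/
theorem cochainClass_mem_closure {L : List (List (Fin n × Bool))} {s : ℤˣ} (c : TreeCover L)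
    (f : c.cochains s) : cochainClass c f ∈ AddSubgroup.closure {x : CochainLimit L s |
      ∃ X : FiniteSubtree n, X.verts.card < linePeriod L + 2 ∧ SupportedOn X x} := by
  generalize hm : {p : c.tree.WhVertex × c.tree.WhVertex | f.1 p.1 p.2 ≠ 0}.ncard = m
  induction m using Nat.strong_induction_on generalizing f with
  | _ m ih =>
    by_cases hf : ∀ a b, f.1 a b = 0
    · rw [show f = 0 from Subtype.ext (funext fun a => funext fun b => hf a b), map_zero]
      exact zero_mem _
    push Not at hf
    obtain ⟨a, b, hab⟩ := hf
    have hadj := TreeCover.adj_of_cochain_ne_zero f hab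
    set g := TreeCover.edgeCochain s c hadj (f.1 a b) with hg
    have hlt : {p : c.tree.WhVertex × c.tree.WhVertex | (f - g).1 p.1 p.2 ≠ 0}.ncard < m := by
      rw [← hm]
      refine Set.ncard_lt_ncard ⟨?_, fun hsub => ?_⟩ (Set.toFinite _)
      · rintro ⟨v, w⟩ hp h0
        simp only at h0
        refine hp ?_
        change f.1 v w - g.1 v w = 0
        by_cases h1 : v = a ∧ w = b
        · obtain ⟨rfl, rfl⟩ := h1
          exact absurd h0 hab
        · by_cases h2 : v = b ∧ w = a
          · obtain ⟨rfl, rfl⟩ := h2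
            rw [TreeCover.cochain_symm f w, TreeCover.cochain_symm g w, hg,
              TreeCover.edgeCochain_left, sub_self]
          · rw [hg, TreeCover.edgeCochain_eq_zero _ _ h1 h2, h0, sub_zero]
      · refine hsub (a := (a, b)) hab ?_
        change f.1 a b - g.1 a b = 0
        rw [hg, TreeCover.edgeCochain_left, sub_self]
    have h1 := ih _ hlt (f - g) rfl
    have h2 : cochainClass c g ∈ AddSubgroup.closure {x : CochainLimit L s |
        ∃ X : FiniteSubtree n, X.verts.card < linePeriod L + 2 ∧ SupportedOn X x} :=
      AddSubgroup.subset_closure (exists_supportedOn_edgeCochain c hadj _)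
    have := add_mem h1 h2
    rwa [← map_add, sub_add_cancel] at this

/-- The quotient map by `H` vanishes on every class of a cochain, and a homomorphism from the direct
limit is determined by these values. -/
theorem closure_eq_top_of_cochainClass_mem {L : List (List (Fin n × Bool))} {s : ℤˣ}
    {H : AddSubgroup (CochainLimit L s)} (h : ∀ (c : TreeCover L) (f : c.cochains s),
      cochainClass c f ∈ H) : H = ⊤ := by
  classical
  rw [← QuotientAddGroup.ker_mk' H, AddMonoidHom.ker_eq_top_iff]
  refine AddCommGroup.DirectLimit.hom_ext _ fun c => AddMonoidHom.ext fun f => ?_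
  exact (QuotientAddGroup.eq_zero_iff _).2 (h c f)

/-! ### Computability of the bound -/

theorem length_flatten_encodeWords (L : List (List (Fin n × Bool))) :
    (encodeWords L).flatten.length = L.flatten.length := by
  simp [encodeWords, List.length_flatten, Function.comp_def]

theorem primrec_factorial : Primrec Nat.factorial := by
  refine (Primrec.nat_rec₁ 1 (f := fun k r => (k + 1) * r) ?_).of_eq fun k => ?_
  · exact Primrec.nat_mul.comp (Primrec.succ.comp Primrec.fst) Primrec.snd
  · induction k with
    | zero => rfl
    | succ k ih => rw [Nat.factorial_succ, ← ih]

theorem computable_bound : Computable₂ fun (L : List (List (ℕ × Bool))) (_ : ℕ) =>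
    L.flatten.length.factorial + 2 :=
  Primrec.to_comp (Primrec.nat_add.comp (primrec_factorial.comp
    (Primrec.list_length.comp (Primrec.list_flatten.comp Primrec.fst))) (Primrec.const 2))

end DecompositionCohomology

theorem mainTheorem9 :
    ∃ N : List (List (ℕ × Bool)) → ℕ → ℕ, Computable₂ N ∧
      ∀ (n : ℕ) (L : List (List (Fin n × Bool))) (s : ℤˣ),
        AddSubgroup.closure
          {x : CochainLimit L s |
            ∃ X : FiniteSubtree n, X.verts.card < N (encodeWords L) n ∧ SupportedOn X x} = ⊤ := by
  refine ⟨_, computable_bound, fun n L s => closure_eq_top_of_cochainClass_mem fun c f => ?_⟩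
  rw [length_flatten_encodeWords]
  exact cochainClass_mem_closure c f
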